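/- Let $G$ be a simple simply-connected complex algebraic group with simply-laced Dynkin diagram on the vertex set $I$, simple roots $\alpha_i$ ($i\in I$), $Q_+=\bigoplus_i\mathbb Z_{\ge 0}\alpha_i$, and let $\rho^\vee$ be the half-sum of the positive coroots. Let $N$ be the maximal unipotent subgroup, $\mathfrak n$ its Lie algebra with Chevalley generators $e_i$, and $\mathbb C[N]=\bigoplus_{\nu\in Q_+}\mathbb C[N]_{-\nu}$ its coordinate ring, with $\mathbb C[N]_{-\nu}$ dual to $U(\mathfrak n)_\nu$ under the pairing $\langle a,f\rangle=(a\cdot f)(1_N)$. For a sequence $\mathbf i=(i_1,\dots,i_p)$ in $I$ put $\beta_k=\alpha_{i_1}+\dots+\alpha_{i_k}$ ($0\le k\le p$), and let $D_{\mathbf i}$ be the push-forward of Lebesgue measure, of total mass $1/p!$, on the simplex $\{c\in\mathbb R_{\ge 0}^{p+1}:\sum_k c_k=1\}$ under the map $c\mapsto-\sum_{k=0}^p c_k\beta_k$ to $\mathfrak t^*_{\mathbb R}$. For $f\in\mathbb C[N]$ set $D(f)=\sum_{\mathbf i}\langle e_{i_1}\cdots e_{i_p},f\rangle D_{\mathbf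 i}$. Let $\mathrm{Seq}(\nu)$ be the set of sequences $\mathbf i$ with $\alpha_{i_1}+\dots+\alpha_{i_p}=\nu$. Let $M$ be a finite-dimensional module over the preprojective algebra $\Lambda$ of the diagram, $\nu=\underrightarrow{\dim}\,M$. For $\mathbf i=(i_1,\dots,i_m)\in\mathrm{Seq}(\nu)$ let $F_{\mathbf i}(M)$ be the variety of chains of submodules $0=M^0\subseteq\dots\subseteq M^m=M$ with $M^k/M^{k-1}\cong S_{i_k}$ for all $k$, and let $\xi_M\in\mathbb C[N]_{-\nu}$ be the element with $\langle e_{i_1}\cdots e_{i_m},\xi_M\rangle=\chi(F_{\mathbf i}(M))$ for all $\mathbf i\in\mathrm{Seq}(\nu)$, where $\chi$ is the topological Euler characteristic. For $n\ge 1$ and $\mu\in Q_+$ let $F_{n,\mu}(M)$ be the variety of chains of submodules $0=M^0\subseteq M^1\subseteq\dots\subseteq M^{n+1}=M$ with $\underrightarrow{\dim}\,M^1+\dots+\underrightarrow{\dim}\,M^n=\mu$. Let $\tau_n:\mathfrak t^*_{\mathbb R}\to\mathfrak t^*_{\mathbb R}$ be scaling by $1/n$. Then $$D(\xi_M)=\sum_{\mathbf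 i\in\mathrm{Seq}(\nu)}\chi(F_{\mathbf i}(M))\,D_{\mathbf i}=\lim_{n\to\infty}\frac1{n^{\rho^\vee(\nu)}}\,(\tau_n)_*\sum_{\mu\in Q_+}\chi(F_{n,\mu}(M))\,\delta_{-\mu},$$ the limit being the weak limit of complex measures on $\mathfrak t^*_{\mathbb R}$, that is, convergence of the integrals of every continuous function on $\mathfrak t^*_{\mathbb R}$ (in particular of every smooth compactly supported one). -/

import Mathlib

open MeasureTheory Filter Topology

noncomputable section

namespace PreprojDH

universe u v w

/-! ### Root data of a simply-laced Dynkin diagram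

The diagram is a simple graph `Γ` on the index set `I`. The real weight space `𝔱*_ℝ` is `I → ℝ`, the
coordinates being those with respect to the simple roots; `Q₊` is `I → ℕ`. -/

section RootData

variable {I : Type v} [Fintype I] [DecidableEq I]

/-- The Cartan matrix `a i j = ⟨αᵢ^∨, αⱼ⟩` of a simply-laced diagram. -/
def cartan (Γ : SimpleGraph I) [DecidableRel Γ.Adj] : Matrix I I ℤ :=
  (2 : ℤ) • (1 : Matrix I I ℤ) - Γ.adjMatrix ℤ

/-- Simply-laced Dynkin diagrams of simple groups (types `A`, `D`, `E`): connected, with positive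
definite Cartan matrix. -/
structure IsSimplyLacedDynkin (Γ : SimpleGraph I) [DecidableRel Γ.Adj] : Prop where
  connected : Γ.Connected
  posDef : ((cartan Γ).map (fun a : ℤ => (a : ℝ))).PosDef

/-- The coroots, in coordinates with respect to the simple coroots: the smallest set that contains
the simple coroots and is stable under the simple reflections `β ↦ β - ⟨β, αᵢ⟩ αᵢ^∨`. -/
inductive IsCoroot (Γ : SimpleGraph I) [DecidableRel Γ.Adj] : (I → ℤ) → Prop
  | simple (i : I) : IsCoroot Γ (Pi.single i 1)
  | reflect (i : I) (β : I → ℤ) : IsCoroot Γ β →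
      IsCoroot Γ (β - Pi.single i (∑ j, β j * cartan Γ j i))

/-- `ρ^∨(ν)`, where `ρ^∨` is the half-sum of the positive coroots. -/
def rhoCheck (Γ : SimpleGraph I) [DecidableRel Γ.Adj] (ν : I → ℕ) : ℝ :=
  (1 / 2) * ∑ᶠ β ∈ {β : I → ℤ | IsCoroot Γ β ∧ 0 ≤ β},
    ((∑ j, ∑ i, β j * cartan Γ j i * (ν i : ℤ) : ℤ) : ℝ)

/-- The embedding of `Q₊` in `𝔱*_ℝ`. -/
def toWeight (ν : I → ℕ) : I → ℝ := fun i => (ν i : ℝ)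

/-- The sum of the simple roots in a sequence. -/
def content (s : List I) : I → ℕ := (s.map fun i => (Pi.single i 1 : I → ℕ)).sum

/-- `Seq(ν)`. -/
def Seq (ν : I → ℕ) : Set (List I) := {s | content s = ν}

end RootData

/-! ### The measures `D_𝐢` -/

section Measures

/-- Lebesgue measure on the standard simplex
`Δ^p = {(c₀, …, c_p) : c_k ≥ 0, c₀ + ⋯ + c_p = 1}`, normalized to have total mass `1 / p!`
(Lebesgue measure in the coordinates `c₁, …, c_p`). -/
def simplexMeasure (p : ℕ) : Measure (Fin (p + 1) → ℝ) :=
  (volume.restrict {c : Fin p → ℝ | (∀ k, 0 ≤ c k) ∧ ∑ k, c k ≤ 1}).map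
    (fun c => Fin.cons (1 - ∑ k, c k) c)

instance (p : ℕ) : IsFiniteMeasure (simplexMeasure p) := by
  have h : IsFiniteMeasure
      ((volume : Measure (Fin p → ℝ)).restrict {c | (∀ k, 0 ≤ c k) ∧ ∑ k, c k ≤ 1}) := by
    refine ⟨?_⟩
    rw [Measure.restrict_apply_univ]
    refine lt_of_le_of_lt (measure_mono (t := Set.Icc 0 1) ?_) measure_Icc_lt_top
    rintro c ⟨h0, h1⟩
    exact ⟨h0, fun k => le_trans (Finset.single_le_sum (fun j _ => h0 j) (Finset.mem_univ k)) h1⟩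
  unfold simplexMeasure
  infer_instance

variable {I : Type v} [Fintype I] [DecidableEq I]

/-- The linear map `π_𝐢(c₀, …, c_p) = - ∑ c_k β_k`, where `β_k` is the sum of the first `k` simple
roots of the sequence. -/
def piMap (s : List I) (c : Fin (s.length + 1) → ℝ) : I → ℝ :=
  -∑ k : Fin (s.length + 1), c k • toWeight (content (s.take k))

/-- The measure `D_𝐢` on `𝔱*_ℝ`. -/
def seqMeasure (s : List I) : Measure (I → ℝ) := (simplexMeasure s.length).map (piMap s)

instance (s : List I) : IsFiniteMeasure (seqMeasure s) := by
  unfold seqMeasure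
  infer_instance

/-- `D_𝐢` as a complex measure. -/
def seqComplexMeasure (s : List I) : ComplexMeasure (I → ℝ) :=
  SignedMeasure.toComplexMeasure (seqMeasure s).toSignedMeasure 0

/-- `m` is the weak limit of the sequence `a`: convergence against all continuous test functions.
It is only used for sequences of complex measures supported in one fixed compact set. -/
def IsWeakLimit (a : ℕ → ComplexMeasure (I → ℝ)) (m : ComplexMeasure (I → ℝ)) : Prop :=
  ∀ φ : (I → ℝ) → ℝ, Continuous φ →
    Tendsto (fun n => ∫ᵛ x, φ x ∂•(a n)) atTop (𝓝 (∫ᵛ x, φ x ∂•m))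

/-- Push-forward under `τ_n`, the scaling of `𝔱*_ℝ` by `1 / n`. -/
def tauPush (n : ℕ) (m : ComplexMeasure (I → ℝ)) : ComplexMeasure (I → ℝ) :=
  m.map (fun x => (1 / (n : ℝ)) • x)

end Measures

/-! ### The algebra `ℂ[N]` and the map `D` -/

section CoordinateRing

variable {I : Type v} [Fintype I] [DecidableEq I] (Γ : SimpleGraph I) [DecidableRel Γ.Adj]

/-- The complex Lie algebra `𝔤` with Dynkin diagram `Γ`. -/
abbrev LieG : Type v := Matrix.ToLieAlgebra ℂ (cartan Γ)

/-- The Chevalley generator `eᵢ` of `𝔤`. -/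
def chevalleyE (i : I) : LieG Γ :=
  LieSubmodule.Quotient.mk (N := CartanMatrix.Relations.toIdeal ℂ (cartan Γ))
    (FreeLieAlgebra.of ℂ (CartanMatrix.Generators.E i))

/-- The positive nilpotent subalgebra `𝔫`, generated by the `eᵢ`. -/
def lieN : LieSubalgebra ℂ (LieG Γ) := LieSubalgebra.lieSpan ℂ (LieG Γ) (Set.range (chevalleyE Γ))

/-- The enveloping algebra `U(𝔫)`. -/
abbrev EnvN : Type v := UniversalEnvelopingAlgebra ℂ (lieN Γ)

/-- The generator `eᵢ` of `U(𝔫)`. -/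
def envE (i : I) : EnvN Γ :=
  UniversalEnvelopingAlgebra.ι ℂ
    (⟨chevalleyE Γ i, LieSubalgebra.subset_lieSpan (Set.mem_range_self i)⟩ : lieN Γ)

/-- The monomial `e_𝐢 = e_{i₁} ⋯ e_{i_p}` in `U(𝔫)`. -/
def envMonomial (s : List I) : EnvN Γ := (s.map (envE Γ)).prod

/-- The graded piece `U(𝔫)_ν`. -/
def envGraded (ν : I → ℕ) : Submodule ℂ (EnvN Γ) := Submodule.span ℂ (envMonomial Γ '' Seq ν)

/-- The weight space `ℂ[N]_{-ν}`, as the dual of `U(𝔫)_ν` under the perfect pairing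
`⟨a, f⟩ = (a · f)(1_N)` between `U(𝔫)` and `ℂ[N]`. -/
def coordWeight (ν : I → ℕ) : Submodule ℂ (Module.Dual ℂ (EnvN Γ)) :=
  ⨅ μ : {μ : I → ℕ // μ ≠ ν}, (envGraded Γ μ).dualAnnihilator

/-- The algebra `ℂ[N]` of regular functions on the unipotent group `N`, as the graded dual
`⨁ ℂ[N]_{-ν}` of `U(𝔫)`; `f a` is the pairing `⟨a, f⟩`. -/
def coordRing : Submodule ℂ (Module.Dual ℂ (EnvN Γ)) := ⨆ ν : I → ℕ, coordWeight Γ ν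

variable {Γ}

/-- The map `D(f) = ∑_𝐢 ⟨e_𝐢, f⟩ D_𝐢` from `ℂ[N]` to measures on `𝔱*_ℝ`. -/
def mapD (f : coordRing Γ) : ComplexMeasure (I → ℝ) :=
  ∑ᶠ s : List I, (f : Module.Dual ℂ (EnvN Γ)) (envMonomial Γ s) • seqComplexMeasure s

end CoordinateRing

/-! ### Modules over the preprojective algebra -/

section Modules

variable {I : Type v}

/-- A finite-dimensional representation of the double quiver of `Γ`: one arrow `i → j` for each
ordered pair of adjacent vertices. -/
structure QuiverRep (Γ : SimpleGraph I) where
  V : I → Type u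
  [addCommGroup : ∀ i, AddCommGroup (V i)]
  [module : ∀ i, Module ℂ (V i)]
  [finiteDimensional : ∀ i, FiniteDimensional ℂ (V i)]
  map : ∀ {i j : I}, Γ.Adj i j → (V i →ₗ[ℂ] V j)

attribute [instance] QuiverRep.addCommGroup QuiverRep.module QuiverRep.finiteDimensional

variable {Γ : SimpleGraph I}

/-- The preprojective relation `∑_h τ(h) M_h M_{h̄} = 0`, written vertex by vertex: a representation
that satisfies it is a (finite-dimensional) module over the preprojective algebra. -/
def IsPreprojective [Fintype I] [DecidableRel Γ.Adj] (τ : Γ.Dart → ℤˣ)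
    (M : QuiverRep.{u} Γ) : Prop :=
  ∀ j : I, ∑ i : {i : I // Γ.Adj i j},
    ((τ ⟨(i.1, j), i.2⟩ : ℤˣ) : ℤ) • (M.map i.2 ∘ₗ M.map i.2.symm) = 0

/-- The dimension vector. -/
def dimVec (M : QuiverRep.{u} Γ) : I → ℕ := fun i => Module.finrank ℂ (M.V i)

/-- Isomorphisms of representations. -/
structure RepIso (M : QuiverRep.{u} Γ) (M' : QuiverRep.{w} Γ) where
  equiv : ∀ i, M.V i ≃ₗ[ℂ] M'.V i
  comm : ∀ {i j : I} (h : Γ.Adj i j) (x : M.V i), equiv j (M.map h x) = M'.map h (equiv i x)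

/-- The simple module `Sᵢ`: one-dimensional at the vertex `i`, zero elsewhere, with zero maps. -/
def simpleRep [DecidableEq I] (Γ : SimpleGraph I) (i : I) : QuiverRep.{0} Γ where
  V := fun j => Fin (if j = i then 1 else 0) → ℂ
  map := fun _ => 0

/-- Submodules. -/
@[ext]
structure SubRep (M : QuiverRep.{u} Γ) where
  carrier : ∀ i, Submodule ℂ (M.V i)
  stable : ∀ {i j : I} (h : Γ.Adj i j) (x : M.V i), x ∈ carrier i → M.map h x ∈ carrier j

namespace SubRep

variable {M : QuiverRep.{u} Γ}

instance : PartialOrder (SubRep M) := PartialOrder.lift SubRep.carrier (fun _ _ h => SubRep.ext h)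

/-- The zero submodule. -/
instance : Bot (SubRep M) := ⟨⟨fun _ => ⊥, fun h x hx => by
  rw [(Submodule.mem_bot ℂ).1 hx, map_zero]; exact Submodule.zero_mem _⟩⟩

/-- The whole module as a submodule. -/
instance : Top (SubRep M) := ⟨⟨fun _ => ⊤, fun _ _ _ => Submodule.mem_top⟩⟩

/-- The dimension vector of a submodule. -/
def dim (N : SubRep M) : I → ℕ := fun i => Module.finrank ℂ (N.carrier i)

/-- The quotient `N' / N` of submodules `N ≤ N'` (in general, `N' / (N ∩ N')`). -/
def subquotient (N N' : SubRep M) : QuiverRep.{u} Γ where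
  V := fun i => (N'.carrier i) ⧸ (N.carrier i).submoduleOf (N'.carrier i)
  map := fun {i j} h => Submodule.mapQ _ _
    ((M.map h).restrict (p := N'.carrier i) (q := N'.carrier j) (fun x hx => N'.stable h x hx))
    (fun x hx => N.stable h x hx)

end SubRep

end Modules

/-! ### Flag varieties, their topology and Euler characteristics -/

section Flags

/-- The classical topology on the Grassmannians of a finite-dimensional complex vector space `V`:
the set of all subspaces is the disjoint union of the `Gr_k(V)`, and `Gr_k(V)` is a quotient of the
space of linearly independent `k`-tuples. -/
@[reducible] def grassmannTopology (V : Type u) [AddCommGroup V] [Module ℂ V] :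
    TopologicalSpace (Submodule ℂ V) :=
  letI : TopologicalSpace V := moduleTopology ℂ V
  TopologicalSpace.coinduced
    (fun b : Σ k : ℕ, {b : Fin k → V // LinearIndependent ℂ b} =>
      Submodule.span ℂ (Set.range b.2.1))
    inferInstance

variable {I : Type v} {Γ : SimpleGraph I}

/-- The set of submodules of `M`, topologized as a subspace of a product of Grassmannians. -/
instance (M : QuiverRep.{u} Γ) : TopologicalSpace (SubRep M) :=
  letI : ∀ i, TopologicalSpace (Submodule ℂ (M.V i)) := fun i => grassmannTopology (M.V i)
  TopologicalSpace.induced SubRep.carrier inferInstance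

/-- The variety `F_𝐢(M)` of composition series of type `𝐢`. -/
def compSeries [DecidableEq I] (M : QuiverRep.{u} Γ) (s : List I) :
    Set (Fin (s.length + 1) → SubRep M) :=
  {N | Monotone N ∧ N 0 = ⊥ ∧ N (Fin.last s.length) = ⊤ ∧
    ∀ k : Fin s.length,
      Nonempty (RepIso (SubRep.subquotient (N k.castSucc) (N k.succ)) (simpleRep Γ (s.get k)))}

/-- The variety `F_{n,μ}(M)` of chains `0 = M⁰ ⊆ M¹ ⊆ ⋯ ⊆ Mⁿ⁺¹ = M` of submodules such that the
dimension vectors of `M¹, …, Mⁿ` add up to `μ`. -/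
def flagVariety (M : QuiverRep.{u} Γ) (n : ℕ) (μ : I → ℕ) : Set (Fin (n + 2) → SubRep M) :=
  {N | Monotone N ∧ N 0 = ⊥ ∧ N (Fin.last (n + 1)) = ⊤ ∧
    ∑ k : Fin n, (N k.succ.castSucc).dim = μ}

/-- The alternating sum of the rational Betti numbers (singular homology). -/
def bettiSum (X : Type w) [TopologicalSpace X] : ℤ :=
  (((AlgebraicTopology.singularChainComplexFunctor (ModuleCat.{w} ℚ)).obj
    (ModuleCat.of ℚ (ULift.{w} ℚ))).obj (TopCat.of X)).homologyEulerChar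

/-- The topological Euler characteristic, computed as the sum of the Euler characteristics of the
connected components. For spaces with finitely many connected components, all of them open and with
finite-dimensional total homology (such as complex projective varieties), it is the alternating sum
of the Betti numbers of `X`. -/
def eulerChar (X : Type w) [TopologicalSpace X] : ℤ :=
  ∑ᶠ c : ConnectedComponents X, bettiSum {x : X // ConnectedComponents.mk x = c}

/-- `[H^•(F_n(M))] = ∑_μ χ(F_{n,μ}(M)) δ_{-μ}`, as a measure on `𝔱*_ℝ`. -/
def flagMeasure (M : QuiverRep.{u} Γ) (n : ℕ) : ComplexMeasure (I → ℝ) :=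
  ∑ᶠ μ : I → ℕ, (eulerChar (flagVariety M n μ) : ℂ) • VectorMeasure.dirac (-toWeight μ) (1 : ℂ)

/-- `ξ` is the element `ξ_M` of `ℂ[N]_{-ν}`, `ν = dim M`, characterized by
`⟨e_𝐢, ξ_M⟩ = χ(F_𝐢(M))` for all `𝐢 ∈ Seq(ν)`. -/
def IsXi [Fintype I] [DecidableEq I] [DecidableRel Γ.Adj] (M : QuiverRep.{u} Γ)
    (ξ : coordRing Γ) : Prop :=
  (ξ : Module.Dual ℂ (EnvN Γ)) ∈ coordWeight Γ (dimVec M) ∧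
    ∀ s ∈ Seq (dimVec M),
      (ξ : Module.Dual ℂ (EnvN Γ)) (envMonomial Γ s) = (eulerChar (compSeries M s) : ℂ)

/-- `∑_{𝐢 ∈ Seq(ν)} χ(F_𝐢(M)) D_𝐢`, `ν = dim M`: the expansion of `D(ξ_M)`. -/
def xiMeasure [Fintype I] [DecidableEq I] (M : QuiverRep.{u} Γ) : ComplexMeasure (I → ℝ) :=
  ∑ᶠ s ∈ Seq (dimVec M), (eulerChar (compSeries M s) : ℂ) • seqComplexMeasure s

end Flags

end PreprojDH

end

open MeasureTheory Filter Topology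

noncomputable section

namespace PreprojDH

universe u v w

/-! ### Euler characteristics and clopen partitions. -/

section EulerCharacteristic

variable {X Y : Type w} [TopologicalSpace X] [TopologicalSpace Y]

/-! Dimension vectors are locally constant on spaces of submodules, so `F_{n,μ}(M)` splits into
finitely many clopen pieces `dimChains M d`, one for each sequence `d` of dimension vectors with sum
`μ`, and `χ` adds up over the pieces (`eulerChar_flagVariety`). Erasing the repetitions in `d`
leaves a strict chain `0 = β₀ < ⋯ < β_r = ν` together with a monotone surjection `Fin (n + 2) → Fin
(r + 1)` that records the multiplicities (`repeatChain`). Up to homeomorphism the piece depends on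
`β` alone (`dimChainsComp`).

For fixed `β` the surjections are the points of `(1/n)ℤ^r` in an `r`-simplex, and the rescaled
weight `-μ/n` is the image of such a point under the affine map with vertices `-β_k`. Testing
against a continuous function therefore gives Riemann sums of order `n^r` (`tendsto_sum_monoSurj`).
Heights force `r ≤ ∑ νᵢ`, and `ρ^∨(ν) = ∑ νᵢ` (`rhoCheck_eq`), so after normalization only the
maximal chains survive. These are the partial sums of the sequences `𝐢 ∈ Seq(ν)`
(`seqChain_bijective`), their varieties are the `F_𝐢(M)` (`compSeries_eq_dimChains`), and the limits
of their Riemann sums are the integrals against `D_𝐢`.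

Since `eulerChar` is a `finsum` over connected components, additivity requires finitely many
components. Chains of submodules are a continuous image of tuples of orthonormal frames, which form
a compact real algebraic set. Such a set has finitely many components
(`finite_connectedComponents_zeroLocus`): a generic-type perturbation of its equation has boundedly
many critical points, and every clopen piece captures one. -/

theorem bettiSum_congr (e : X ≃ₜ Y) : bettiSum X = bettiSum Y := by
  have e' := ((AlgebraicTopology.singularChainComplexFunctor (ModuleCat.{w} ℚ)).obj
    (ModuleCat.of ℚ (ULift.{w} ℚ))).mapIso (TopCat.isoOfHomeo (X := .of X) (Y := .of Y) e)
  unfold bettiSum HomologicalComplex.homologyEulerChar GradedObject.eulerChar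
  refine finsum_congr fun i => ?_
  have h := (HomologicalComplex.homologyMapIso e' i).toLinearEquiv.finrank_eq
  rw [h]

theorem homeomorph_mk_eq_mk_iff (e : X ≃ₜ Y) (x x' : X) :
    ConnectedComponents.mk (e x) = ConnectedComponents.mk (e x') ↔
      ConnectedComponents.mk x = ConnectedComponents.mk x' := by
  constructor
  · intro h
    have := congrArg e.symm.continuous.connectedComponentsMap h
    simpa using this
  · intro h
    exact congrArg e.continuous.connectedComponentsMap h

/-- A homeomorphism induces a bijection on connected components. -/
def componentsCongr (e : X ≃ₜ Y) : ConnectedComponents X ≃ ConnectedComponents Y where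
  toFun := e.continuous.connectedComponentsMap
  invFun := e.symm.continuous.connectedComponentsMap
  left_inv c := by
    obtain ⟨x, rfl⟩ := ConnectedComponents.surjective_coe c
    exact congrArg ConnectedComponents.mk (e.symm_apply_apply x)
  right_inv c := by
    obtain ⟨x, rfl⟩ := ConnectedComponents.surjective_coe c
    exact congrArg ConnectedComponents.mk (e.apply_symm_apply x)

theorem eulerChar_congr (e : X ≃ₜ Y) : eulerChar X = eulerChar Y := by
  unfold eulerChar
  refine finsum_eq_of_bijective (componentsCongr e) (componentsCongr e).bijective fun c => ?_
  refine bettiSum_congr (e.subtype fun x => ?_)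
  obtain ⟨x', rfl⟩ := ConnectedComponents.surjective_coe c
  exact (homeomorph_mk_eq_mk_iff e x x').symm

/-- Transfers finiteness from spaces of frames to the spaces of chains that they span. -/
theorem finite_connectedComponents_of_surjective {X : Type*} {Y : Type*} [TopologicalSpace X]
    [TopologicalSpace Y] [Finite (ConnectedComponents X)] {f : X → Y} (hf : Continuous f)
    (hs : Function.Surjective f) : Finite (ConnectedComponents Y) := by
  refine Finite.of_surjective hf.connectedComponentsMap fun c => ?_
  obtain ⟨y, rfl⟩ := ConnectedComponents.surjective_coe c
  obtain ⟨x, rfl⟩ := hs y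
  exact ⟨ConnectedComponents.mk x, rfl⟩

/-- Additivity of the Euler characteristic over a finite partition into clopen sets. -/
theorem eulerChar_eq_sum {ι : Type*} [Fintype ι] {U : ι → Set X} (hU : ∀ i, IsClopen (U i))
    (hdisj : Pairwise (Function.onFun Disjoint U)) (hunion : ⋃ i, U i = Set.univ)
    (hfin : ∀ i, Finite (ConnectedComponents (U i))) :
    eulerChar X = ∑ i, eulerChar (U i) := by
  let E := ConnectedComponents.equivOfIsClopen hU hdisj hunion
  have := fun i => Fintype.ofFinite (ConnectedComponents (U i))
  have : Finite (ConnectedComponents X) := Finite.of_equiv _ E.symm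
  unfold eulerChar
  simp_rw [finsum_eq_sum_of_fintype]
  rw [← Fintype.sum_sigma', finsum_eq_of_bijective E E.bijective (g := fun c : Σ i, ConnectedComponents (U i) =>
    bettiSum {x : U c.1 // ConnectedComponents.mk x = c.2}) ?_, finsum_eq_sum_of_fintype]
  intro c
  obtain ⟨⟨i, d⟩, rfl⟩ := E.symm.surjective c
  obtain ⟨y, rfl⟩ := ConnectedComponents.surjective_coe d
  rw [E.apply_symm_apply]
  -- A component of `X` lies inside one clopen piece and is, as a set, a component of that piece.
  -- The homeomorphism at the end is then the identity on points.
  have key : ∀ x : X, ConnectedComponents.mk x = E.symm ⟨i, ConnectedComponents.mk y⟩ ↔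
      ∃ hx : x ∈ U i, ConnectedComponents.mk (⟨x, hx⟩ : U i) = ConnectedComponents.mk y := by
    intro x
    rw [E.eq_symm_apply]
    obtain ⟨j, hj⟩ := Set.iUnion_eq_univ_iff.mp hunion x
    rw [ConnectedComponents.equivOfIsClopen_mk hU hdisj hunion x hj]
    constructor
    · intro h
      obtain rfl : j = i := congrArg Sigma.fst h
      exact ⟨hj, eq_of_heq (Sigma.mk.inj h).2⟩
    · rintro ⟨hx, h⟩
      obtain rfl : j = i := hdisj.eq (Set.not_disjoint_iff.2 ⟨x, hj, hx⟩)
      rw [h]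
  refine bettiSum_congr
    { toFun := fun x => ⟨⟨x.1, ((key x.1).1 x.2).1⟩, ((key x.1).1 x.2).2⟩
      invFun := fun x => ⟨x.1.1, (key _).2 ⟨x.1.2, x.2⟩⟩
      left_inv := fun _ => rfl
      right_inv := fun _ => rfl
      continuous_toFun := by fun_prop
      continuous_invFun := by fun_prop }

end EulerCharacteristic

/-! ### Compact real algebraic sets have finitely many connected components. -/

section RealAlgebraic

variable {σ : Type*} [Fintype σ] [DecidableEq σ]

omit [Fintype σ] in
open MvPolynomial in
theorem hasDerivAt_eval_update (p : MvPolynomial σ ℝ) (x : σ → ℝ) (i : σ) (t : ℝ) :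
    HasDerivAt (fun t => eval (Function.update x i t) p)
      (eval (Function.update x i t) (pderiv i p)) t := by
  induction p using MvPolynomial.induction_on with
  | C a => simpa using hasDerivAt_const t a
  | add p q hp hq =>
    simp only [map_add]
    exact hp.add hq
  | mul_X p j hp =>
    have hj : HasDerivAt (fun t => eval (Function.update x i t) (X j : MvPolynomial σ ℝ))
        (eval (Function.update x i t) (pderiv i (X j : MvPolynomial σ ℝ))) t := by
      by_cases h : j = i
      · subst h
        simp only [eval_X, Function.update_self, pderiv_X_self, map_one]
        exact hasDerivAt_id t
      · simpa [h, pderiv_X_of_ne (R := ℝ) h] using hasDerivAt_const t (x j)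
    have := hp.mul hj
    simp only [Derivation.leibniz, map_mul, map_add, smul_eq_mul]
    refine this.congr_deriv ?_
    ring

omit [Fintype σ] in
open MvPolynomial in
theorem eval_pderiv_eq_zero_of_isLocalMin {p : MvPolynomial σ ℝ} {x : σ → ℝ}
    (h : IsLocalMin (fun y => eval y p) x) (i : σ) : eval x (pderiv i p) = 0 := by
  have hd := hasDerivAt_eval_update p x i (x i)
  rw [Function.update_eq_self] at hd
  refine IsLocalMin.hasDerivAt_eq_zero ?_ hd
  have hc : Continuous fun t : ℝ => Function.update x i t := by fun_prop
  have ht : Tendsto (fun t : ℝ => Function.update x i t) (𝓝 (x i)) (𝓝 x) := by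
    have := hc.tendsto (x i)
    rwa [Function.update_eq_self] at this
  have := ht.eventually h
  simpa [IsLocalMin, IsMinFilter] using this

omit [Fintype σ] [DecidableEq σ] in
open MvPolynomial in
theorem totalDegree_pderiv_le (i : σ) (p : MvPolynomial σ ℝ) :
    (pderiv i p).totalDegree ≤ p.totalDegree := by
  classical
  conv_lhs => rw [p.as_sum, map_sum]
  refine totalDegree_finsetSum_le fun c hc => ?_
  rw [pderiv_monomial]
  refine (totalDegree_monomial_le _ _).trans (le_trans ?_ (le_totalDegree hc))
  exact Finsupp.degree_mono (tsub_le_self : c - Finsupp.single i 1 ≤ c)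

/-- The restriction of a polynomial to a set of points. -/
def polyRestrict (S : Set (σ → ℝ)) : MvPolynomial σ ℝ →ₐ[ℝ] (S → ℝ) :=
  AlgHom.pi fun s : S => MvPolynomial.aeval (s : σ → ℝ)

omit [Fintype σ] [DecidableEq σ] in
@[simp] theorem polyRestrict_apply (S : Set (σ → ℝ)) (p : MvPolynomial σ ℝ) (s : S) :
    polyRestrict S p s = MvPolynomial.eval (s : σ → ℝ) p := by
  simp [polyRestrict]

-- Lagrange interpolation: the indicator of `s` is a product of affine functions, each equal to `1`
-- at `s` and to `0` at one other point.
omit [Fintype σ] [DecidableEq σ] in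
theorem polyRestrict_surjective (S : Set (σ → ℝ)) [Finite S] :
    Function.Surjective (polyRestrict S) := by
  classical
  have := Fintype.ofFinite S
  have key : ∀ s : S, ∃ p, polyRestrict S p = Pi.single s 1 := by
    intro s
    have h2 : ∀ t : S, t ≠ s → ∃ q : MvPolynomial σ ℝ, MvPolynomial.eval (t : σ → ℝ) q = 0 ∧
        MvPolynomial.eval (s : σ → ℝ) q = 1 := by
      intro t ht
      obtain ⟨i, hi⟩ : ∃ i, (t : σ → ℝ) i ≠ (s : σ → ℝ) i := by
        by_contra! h
        exact ht (Subtype.ext (funext h))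
      refine ⟨MvPolynomial.C ((s : σ → ℝ) i - (t : σ → ℝ) i)⁻¹ *
        (MvPolynomial.X i - MvPolynomial.C ((t : σ → ℝ) i)), by simp, ?_⟩
      simp only [map_mul, MvPolynomial.eval_C, map_sub, MvPolynomial.eval_X]
      exact inv_mul_cancel₀ (sub_ne_zero.2 hi.symm)
    choose! q hq0 hq1 using h2
    refine ⟨∏ t ∈ Finset.univ.erase s, q t, ?_⟩
    ext t
    rw [polyRestrict_apply, map_prod]
    by_cases h : t = s
    · subst h
      rw [Pi.single_eq_same]
      exact Finset.prod_eq_one fun t ht => hq1 t (Finset.ne_of_mem_erase ht)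
    · rw [Pi.single_eq_of_ne h]
      exact Finset.prod_eq_zero (Finset.mem_erase.2 ⟨h, Finset.mem_univ t⟩) (hq0 t h)
  choose p hp using key
  intro g
  refine ⟨∑ s, g s • p s, ?_⟩
  rw [map_sum]
  simp_rw [map_smul, hp]
  ext t
  simp [Finset.sum_apply, Pi.single_apply]

open MvPolynomial in
/-- A system of equations `xᵢ ^ d = gᵢ(x)`, `deg gᵢ < d`, has at most `d ^ N` solutions. -/
theorem card_le_of_forall_pow_eq {d : ℕ} (g : σ → MvPolynomial σ ℝ)
    (hg : ∀ i, (g i).totalDegree < d) (S : Set (σ → ℝ)) [Finite S]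
    (hS : ∀ s ∈ S, ∀ i, s i ^ d = eval s (g i)) : Nat.card S ≤ d ^ Fintype.card σ := by
  classical
  have := Fintype.ofFinite S
  -- `W` is spanned by the `d ^ N` monomials with all exponents below `d`. Once it is shown to
  -- contain every function on `S`, comparing dimensions gives the bound.
  let W : Submodule ℝ (S → ℝ) := Submodule.span ℝ (Set.range fun a : σ → Fin d =>
    polyRestrict S (∏ i, X i ^ (a i : ℕ)))
  have hmon : ∀ n : ℕ, ∀ a : σ →₀ ℕ, a.degree ≤ n → polyRestrict S (monomial a 1) ∈ W := by
    intro n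
    induction n using Nat.strong_induction_on with
    | _ n ih =>
      intro a ha
      by_cases h : ∀ i, a i < d
      · refine Submodule.subset_span ⟨fun i => ⟨a i, h i⟩, ?_⟩
        rw [monomial_eq, C_1, one_mul, Finsupp.prod_fintype _ _ (by simp)]
      · push Not at h
        obtain ⟨i, hi⟩ := h
        -- On `S` the factor `xᵢ ^ d` may be replaced by `gᵢ`, which strictly lowers the total
        -- degree, so the induction applies.
        let b := a - Finsupp.single i d
        have hab : a = b + Finsupp.single i d := by
          rw [tsub_add_cancel_of_le]
          simpa using hi
        have hdeg : a.degree = b.degree + d := by rw [hab]; simp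
        have heq : polyRestrict S (monomial a 1) = polyRestrict S (monomial b 1 * g i) := by
          ext s
          rw [polyRestrict_apply, polyRestrict_apply, hab, ← mul_one (1 : ℝ), ← monomial_mul,
            map_mul, map_mul, mul_one, ← hS s s.2 i, ← X_pow_eq_monomial]
          simp
        rw [heq, (g i).as_sum, Finset.mul_sum, map_sum]
        refine Submodule.sum_mem _ fun c hc => ?_
        rw [monomial_mul, one_mul, ← mul_one (coeff c (g i)), ← smul_eq_mul, ← smul_monomial,
          map_smul]
        refine Submodule.smul_mem _ _ (ih (b + c).degree ?_ _ le_rfl)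
        have h1 := le_totalDegree hc
        have h2 := hg i
        have h3 : (c.sum fun _ e => e) = c.degree := rfl
        rw [map_add]
        omega
  have htop : W = ⊤ := by
    refine top_unique fun f _ => ?_
    obtain ⟨p, rfl⟩ := polyRestrict_surjective S f
    rw [p.as_sum, map_sum]
    refine Submodule.sum_mem _ fun c _ => ?_
    rw [← mul_one (coeff c p), ← smul_eq_mul, ← smul_monomial, map_smul]
    exact Submodule.smul_mem _ _ (hmon _ c le_rfl)
  have hle : Module.finrank ℝ W ≤ Fintype.card (σ → Fin d) := finrank_range_le_card _
  rw [htop, finrank_top, Module.finrank_fintype_fun_eq_card] at hle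
  simpa [Nat.card_eq_fintype_card] using hle

open MvPolynomial in
/-- A compact real algebraic set has finitely many connected components. -/
theorem finite_connectedComponents_zeroLocus {f : MvPolynomial σ ℝ} (hf : ∀ x, 0 ≤ eval x f)
    (hc : IsCompact {x : σ → ℝ | eval x f = 0}) :
    Finite (ConnectedComponents {x : σ → ℝ | eval x f = 0}) := by
  rw [← not_infinite_iff_finite]
  intro hinf
  set Z : Set (σ → ℝ) := {x | eval x f = 0} with hZ
  -- `n` is one more than the number of critical points that `f + ε ∑ xᵢ ^ (2D)` can have.
  -- Infinitely many components would give `n` disjoint nonempty clopen pieces, each of which will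
  -- produce a critical point.
  set D := f.totalDegree + 1 with hD
  set n := (2 * D - 1) ^ Fintype.card σ + 1 with hn
  obtain ⟨U, hU, hne, hdisj, hunion⟩ :=
    ConnectedComponents.exists_fun_isClopen_of_infinite Z n (Nat.succ_pos _)
  let Y : Fin n → Set (σ → ℝ) := fun k => Subtype.val '' U k
  have : CompactSpace Z := isCompact_iff_compactSpace.1 hc
  have hYc : ∀ k, IsCompact (Y k) := fun k =>
    ((hU k).isClosed.isCompact).image continuous_subtype_val
  have hYdisj : ∀ k l, k ≠ l → Disjoint (Y k) (Y l) := fun k l h =>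
    (Set.disjoint_image_iff Subtype.val_injective).2 (hdisj h)
  have hYZ : ∀ x ∈ Z, ∃ k, x ∈ Y k := fun x hx => by
    obtain ⟨k, hk⟩ := Set.iUnion_eq_univ_iff.mp hunion ⟨x, hx⟩
    exact ⟨k, ⟨x, hx⟩, hk, rfl⟩
  have hYsub : ∀ k, Y k ⊆ Z := by
    rintro k _ ⟨x, -, rfl⟩
    exact x.2
  obtain ⟨δ, hδ, hδdisj⟩ : ∃ δ : ℝ, 0 < δ ∧ ∀ k l, k ≠ l →
      Disjoint (Metric.cthickening δ (Y k)) (Metric.cthickening δ (Y l)) := by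
    have h1 : ∀ k l, ∀ᶠ δ in 𝓝[>] (0 : ℝ), k ≠ l →
        Disjoint (Metric.cthickening δ (Y k)) (Metric.cthickening δ (Y l)) := by
      intro k l
      by_cases hkl : k = l
      · simp [hkl]
      obtain ⟨δ, hδ, h⟩ := (hYdisj k l hkl).exists_cthickenings (hYc k) (hYc l).isClosed
      filter_upwards [Ioo_mem_nhdsGT hδ] with ε hε _
      exact h.mono (Metric.cthickening_mono hε.2.le _) (Metric.cthickening_mono hε.2.le _)
    have h2 : ∀ᶠ δ in 𝓝[>] (0 : ℝ), ∀ k l, k ≠ l →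
        Disjoint (Metric.cthickening δ (Y k)) (Metric.cthickening δ (Y l)) :=
      eventually_all.2 fun k => eventually_all.2 fun l => h1 k l
    obtain ⟨δ, h, hδ⟩ := (h2.and self_mem_nhdsWithin).exists
    exact ⟨δ, hδ, h⟩
  let K : Fin n → Set (σ → ℝ) := fun k => Metric.cthickening δ (Y k)
  have hKc : ∀ k, IsCompact (K k) := fun k => (hYc k).cthickening
  have hYK : ∀ k, Y k ⊆ Metric.thickening δ (Y k) := fun k => Metric.self_subset_thickening hδ _
  have hTK : ∀ k, Metric.thickening δ (Y k) ⊆ K k := fun k => Metric.thickening_subset_cthickening _ _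
  -- The shells around the pieces are compact and contain no zero of `f`, so `f` is bounded below on
  -- them by a positive constant.
  obtain ⟨η, hη, hηC⟩ : ∃ η, 0 < η ∧
      ∀ x ∈ ⋃ k, K k \ Metric.thickening δ (Y k), η ≤ eval x f := by
    refine IsCompact.exists_forall_le' (isCompact_iUnion fun k =>
      (hKc k).diff Metric.isOpen_thickening) (MvPolynomial.continuous_eval f).continuousOn ?_
    intro x hx
    obtain ⟨k, hxK, hxT⟩ := Set.mem_iUnion.1 hx
    refine lt_of_le_of_ne (hf x) fun h0 => ?_
    obtain ⟨l, hl⟩ := hYZ x h0.symm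
    by_cases hkl : k = l
    · subst hkl
      exact hxT (hYK _ hl)
    · exact Set.disjoint_left.1 (hδdisj k l hkl) hxK (hTK l (hYK l hl))
  let h : MvPolynomial σ ℝ := ∑ i, X i ^ (2 * D)
  have hh0 : ∀ x, 0 ≤ eval x h := fun x => by
    simp only [h, map_sum, map_pow, eval_X]
    exact Finset.sum_nonneg fun i _ => by rw [pow_mul]; positivity
  obtain ⟨H, hH⟩ := (isCompact_iUnion hKc).exists_bound_of_continuousOn
    (MvPolynomial.continuous_eval h).continuousOn
  have hH' : ∀ k, ∀ x ∈ K k, eval x h ≤ |H| := fun k x hx =>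
    (le_abs_self _).trans ((hH x (Set.mem_iUnion.2 ⟨k, hx⟩)).trans (le_abs_self H))
  -- Chosen so that `ε h < η` on all the `K k`: then `F` is smaller at a zero of `f` than anywhere
  -- on a shell, and its minimum over `K k` is attained in the interior.
  let ε : ℝ := η / (|H| + 1)
  have hHpos : 0 < |H| + 1 := by positivity
  have hε : 0 < ε := div_pos hη hHpos
  have hεH : ε * |H| < η := by
    have : ε * (|H| + 1) = η := div_mul_cancel₀ _ hHpos.ne'
    linarith
  let F : MvPolynomial σ ℝ := f + C ε * h
  have hF : ∀ x, eval x F = eval x f + ε * eval x h := fun x => by simp [F]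
  have hmin : ∀ k, ∃ x ∈ K k, ∀ i, eval x (pderiv i F) = 0 := by
    intro k
    obtain ⟨y, hy⟩ : (Y k).Nonempty := (hne k).image _
    obtain ⟨x, hxK, hx⟩ := (hKc k).exists_isMinOn ⟨y, hTK k (hYK k hy)⟩
      (MvPolynomial.continuous_eval F).continuousOn
    have hxT : x ∈ Metric.thickening δ (Y k) := by
      by_contra hxT
      have h1 := hηC x (Set.mem_iUnion.2 ⟨k, hxK, hxT⟩)
      have h2 : eval x F ≤ eval y F := hx (hTK k (hYK k hy))
      have h3 : eval y f = 0 := hYsub k hy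
      have h4 := mul_le_mul_of_nonneg_left (hH' k y (hTK k (hYK k hy))) hε.le
      have h5 := mul_nonneg hε.le (hh0 x)
      rw [hF, hF] at h2
      linarith
    refine ⟨x, hxK, eval_pderiv_eq_zero_of_isLocalMin ?_⟩
    exact hx.isLocalMin (mem_of_superset (Metric.isOpen_thickening.mem_nhds hxT) (hTK k))
  choose x hxK hx using hmin
  have hxinj : Function.Injective x := fun k l hkl => by
    by_contra hne
    exact Set.disjoint_left.1 (hδdisj k l hne) (hxK k) (hkl ▸ hxK l)
  have hpd : ∀ i, pderiv i h = C (2 * D : ℝ) * X i ^ (2 * D - 1) := by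
    intro i
    simp only [h, map_sum, Derivation.leibniz_pow]
    rw [Finset.sum_eq_single i]
    · rw [pderiv_X_self, C_mul, map_natCast C D, show (C (2 : ℝ) : MvPolynomial σ ℝ) = 2 from
        map_ofNat C 2]
      simp
    · intro j _ hj
      rw [pderiv_X_of_ne hj]
      simp
    · simp
  have hεD : ε * (2 * D : ℝ) ≠ 0 := by positivity
  -- `∂ᵢF = 0` reads `xᵢ ^ (2D-1) = -(2Dε)⁻¹ ∂ᵢf`, with right side of degree at most `D - 1 < 2D -
  -- 1`.
  have hcard := card_le_of_forall_pow_eq (d := 2 * D - 1)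
    (fun i => C (-(ε * (2 * D : ℝ))⁻¹) * pderiv i f) (fun i => ?_) (Set.range x) ?_
  · rw [Nat.card_range_of_injective hxinj, Nat.card_fin] at hcard
    omega
  · have h1 := totalDegree_mul (C (-(ε * (2 * D : ℝ))⁻¹)) (pderiv i f)
    have h2 := totalDegree_pderiv_le i f
    rw [totalDegree_C] at h1
    omega
  · rintro _ ⟨k, rfl⟩ i
    have h1 := hx k i
    simp only [F, map_add, Derivation.leibniz, pderiv_C, hpd, smul_eq_mul, mul_zero, add_zero,
      map_mul, eval_C, map_pow, eval_X] at h1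
    rw [map_mul, eval_C, eq_neg_of_add_eq_zero_left h1, neg_mul_neg]
    have hD0 : (D : ℝ) ≠ 0 := Nat.cast_ne_zero.2 (Nat.succ_ne_zero _)
    field_simp

/-- Real algebraic subsets of `ℝ^σ`, as zero sets of single nonnegative polynomials. -/
def IsAlgebraicSet (Z : Set (σ → ℝ)) : Prop :=
  ∃ f : MvPolynomial σ ℝ, (∀ x, 0 ≤ MvPolynomial.eval x f) ∧ Z = {x | MvPolynomial.eval x f = 0}

theorem IsAlgebraicSet.finite_connectedComponents {Z : Set (σ → ℝ)} (hZ : IsAlgebraicSet Z)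
    (hc : IsCompact Z) : Finite (ConnectedComponents Z) := by
  obtain ⟨f, hf, rfl⟩ := hZ
  exact finite_connectedComponents_zeroLocus hf hc

omit [Fintype σ] [DecidableEq σ] in
theorem IsAlgebraicSet.isClosed {Z : Set (σ → ℝ)} (hZ : IsAlgebraicSet Z) : IsClosed Z := by
  obtain ⟨f, -, rfl⟩ := hZ
  exact isClosed_eq (MvPolynomial.continuous_eval f) continuous_const

-- A sum of nonnegative polynomials vanishes exactly where all of them do. This is the use of
-- nonnegativity in `IsAlgebraicSet`.
omit [Fintype σ] [DecidableEq σ] in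
theorem IsAlgebraicSet.iInter {ι : Sort*} [Finite ι] {Z : ι → Set (σ → ℝ)}
    (hZ : ∀ i, IsAlgebraicSet (Z i)) : IsAlgebraicSet (⋂ i, Z i) := by
  have := Fintype.ofFinite (PLift ι)
  choose f hf hZ using hZ
  refine ⟨∑ i : PLift ι, f i.down, fun x => ?_, ?_⟩
  · rw [map_sum]
    exact Finset.sum_nonneg fun i _ => hf _ x
  · ext x
    rw [Set.mem_iInter, Set.mem_ofPred_eq, map_sum,
      Finset.sum_eq_zero_iff_of_nonneg fun i _ => hf _ x]
    simp [hZ, PLift.forall]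

omit [Fintype σ] [DecidableEq σ] in
theorem IsAlgebraicSet.inter {Y Z : Set (σ → ℝ)} (hY : IsAlgebraicSet Y)
    (hZ : IsAlgebraicSet Z) : IsAlgebraicSet (Y ∩ Z) := by
  rw [Set.inter_eq_iInter]
  exact .iInter fun b => by cases b <;> assumption

/-- Complex-valued polynomial functions in real variables. -/
def IsPolyFun (h : (σ → ℝ) → ℂ) : Prop :=
  ∃ p q : MvPolynomial σ ℝ, ∀ x, h x = ⟨MvPolynomial.eval x p, MvPolynomial.eval x q⟩

namespace IsPolyFun

variable {h h' : (σ → ℝ) → ℂ}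

omit [Fintype σ] [DecidableEq σ] in
theorem const (c : ℂ) : IsPolyFun fun _ : σ → ℝ => c :=
  ⟨.C c.re, .C c.im, fun x => by simp⟩

omit [Fintype σ] [DecidableEq σ] in
theorem mk_coord (i j : σ) : IsPolyFun fun x : σ → ℝ => (⟨x i, x j⟩ : ℂ) :=
  ⟨.X i, .X j, fun x => by simp⟩

omit [Fintype σ] [DecidableEq σ] in
theorem add (hh : IsPolyFun h) (hh' : IsPolyFun h') : IsPolyFun fun x => h x + h' x := by
  obtain ⟨p, q, hpq⟩ := hh
  obtain ⟨p', q', hpq'⟩ := hh'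
  exact ⟨p + p', q + q', fun x => by simp [hpq, hpq', Complex.ext_iff]⟩

omit [Fintype σ] [DecidableEq σ] in
theorem sub (hh : IsPolyFun h) (hh' : IsPolyFun h') : IsPolyFun fun x => h x - h' x := by
  obtain ⟨p, q, hpq⟩ := hh
  obtain ⟨p', q', hpq'⟩ := hh'
  exact ⟨p - p', q - q', fun x => by simp [hpq, hpq', Complex.ext_iff]⟩

omit [Fintype σ] [DecidableEq σ] in
theorem mul (hh : IsPolyFun h) (hh' : IsPolyFun h') : IsPolyFun fun x => h x * h' x := by
  obtain ⟨p, q, hpq⟩ := hh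
  obtain ⟨p', q', hpq'⟩ := hh'
  exact ⟨p * p' - q * q', p * q' + q * p', fun x => by simp [hpq, hpq', Complex.ext_iff]⟩

omit [Fintype σ] [DecidableEq σ] in
theorem conj (hh : IsPolyFun h) : IsPolyFun fun x => (starRingEnd ℂ) (h x) := by
  obtain ⟨p, q, hpq⟩ := hh
  exact ⟨p, -q, fun x => by simp [hpq, Complex.ext_iff]⟩

omit [Fintype σ] [DecidableEq σ] in
theorem sum {ι : Type*} {s : Finset ι} {h : ι → (σ → ℝ) → ℂ} (hh : ∀ i ∈ s, IsPolyFun (h i)) :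
    IsPolyFun fun x => ∑ i ∈ s, h i x := by
  classical
  induction s using Finset.induction_on with
  | empty => simpa using const 0
  | insert a s ha ih =>
    simp only [Finset.sum_insert ha]
    exact (hh a (Finset.mem_insert_self a s)).add
      (ih fun i hi => hh i (Finset.mem_insert_of_mem hi))

-- The real and imaginary parts of the equation are merged into one by a sum of squares.
omit [Fintype σ] [DecidableEq σ] in
theorem isAlgebraicSet_eq (hh : IsPolyFun h) (hh' : IsPolyFun h') :
    IsAlgebraicSet {x | h x = h' x} := by
  obtain ⟨p, q, hpq⟩ := hh.sub hh'
  refine ⟨p * p + q * q, fun x => ?_, ?_⟩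
  · simp only [map_add, map_mul]
    nlinarith [mul_self_nonneg (MvPolynomial.eval x p), mul_self_nonneg (MvPolynomial.eval x q)]
  · ext x
    change h x = h' x ↔ MvPolynomial.eval x (p * p + q * q) = 0
    rw [← sub_eq_zero, show h x - h' x = _ from hpq x, Complex.ext_iff, map_add, map_mul, map_mul,
      mul_self_add_mul_self_eq_zero]
    rfl

end IsPolyFun

end RealAlgebraic

/-! ### Chains of submodules parametrized by orthonormal frames. -/

section Frames

theorem exists_orthonormal_span_eq {W : Type*} [NormedAddCommGroup W] [InnerProductSpace ℂ W]
    [FiniteDimensional ℂ W] (S : Submodule ℂ W) {m : ℕ} (hm : Module.finrank ℂ S = m) :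
    ∃ b : Fin m → W, Orthonormal ℂ b ∧ Submodule.span ℂ (Set.range b) = S := by
  subst hm
  let B := stdOrthonormalBasis ℂ S
  refine ⟨fun a => (B a : W), B.orthonormal.comp_linearIsometry S.subtypeₗᵢ, ?_⟩
  have h := B.toBasis.span_eq
  rw [OrthonormalBasis.coe_toBasis] at h
  have h' := congrArg (Submodule.map S.subtype) h
  rwa [Submodule.map_span, ← Set.range_comp, Submodule.map_top, Submodule.range_subtype] at h'

/-- Rewrites membership in a span as an equation that is polynomial in real coordinates. Inclusions
and stability under the structure maps thereby become algebraic conditions on frames. -/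
theorem mem_span_range_iff_of_orthonormal {W : Type*} [NormedAddCommGroup W]
    [InnerProductSpace ℂ W] {m : ℕ} {b : Fin m → W} (hb : Orthonormal ℂ b) (x : W) :
    x ∈ Submodule.span ℂ (Set.range b) ↔ x = ∑ a, inner ℂ (b a) x • b a := by
  constructor
  · intro h
    obtain ⟨c, rfl⟩ := (Submodule.mem_span_range_iff_exists_fun ℂ).1 h
    simp_rw [hb.inner_right_fintype]
  · intro h
    rw [h]
    exact Submodule.sum_mem _ fun a _ => Submodule.smul_mem _ _ (Submodule.subset_span ⟨a, rfl⟩)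

end Frames

section Chains

variable {I : Type v} {Γ : SimpleGraph I}

/-- Chains of submodules with prescribed dimension vectors. -/
def dimChains (M : QuiverRep.{u} Γ) {J : Type w} [Preorder J] (d : J → I → ℕ) :
    Set (J → SubRep M) :=
  {N | Monotone N ∧ ∀ k, (N k).dim = d k}

variable (M : QuiverRep.{u} Γ)

/-- Real coordinates of tuples of frames. -/
abbrev FrameIndex {J : Type w} (d : J → I → ℕ) : Type _ :=
  Σ (k : J) (i : I), Fin (d k i) × Fin (Module.finrank ℂ (M.V i)) × Bool

/-- The hermitian space used as a model for `V i`. -/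
abbrev Model (i : I) : Type := EuclideanSpace ℂ (Fin (Module.finrank ℂ (M.V i)))

/-- Coordinates on `V i`. -/
def modelEquiv (i : I) : M.V i ≃ₗ[ℂ] Model M i :=
  LinearEquiv.ofFinrankEq _ _ (by simp)

/-- The structure maps in coordinates. -/
def modelMap {i j : I} (h : Γ.Adj i j) : Model M i →ₗ[ℂ] Model M j :=
  (modelEquiv M j).toLinearMap ∘ₗ M.map h ∘ₗ (modelEquiv M i).symm.toLinearMap

theorem mem_span_modelEquiv_symm {i : I} {m : ℕ} (b : Fin m → Model M i) (v : M.V i) :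
    v ∈ Submodule.span ℂ (Set.range fun a => (modelEquiv M i).symm (b a)) ↔
      modelEquiv M i v ∈ Submodule.span ℂ (Set.range b) := by
  have : Set.range (fun a => (modelEquiv M i).symm (b a)) =
      (modelEquiv M i).symm.toLinearMap '' Set.range b := by
    rw [← Set.range_comp]; rfl
  rw [this, ← Submodule.map_span]
  constructor
  · rintro ⟨w, hw, rfl⟩
    simpa using hw
  · exact fun h => ⟨_, h, by simp⟩

variable {J : Type w} {d : J → I → ℕ}

/-- The vectors with given real coordinates. -/
def frame (x : FrameIndex M d → ℝ) (k : J) (i : I) (a : Fin (d k i)) : Model M i :=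
  WithLp.toLp 2 fun c => ⟨x ⟨k, i, a, c, false⟩, x ⟨k, i, a, c, true⟩⟩

variable (d) in
/-- The set of tuples of orthonormal frames that span chains of submodules. -/
def frameChains [Preorder J] : Set (FrameIndex M d → ℝ) :=
  {x | (∀ k i, Orthonormal ℂ (frame M x k i)) ∧
    (∀ k l, k ≤ l → ∀ i a, frame M x k i a = ∑ a', inner ℂ (frame M x l i a') (frame M x k i a) •
      frame M x l i a') ∧
    ∀ k i j (h : Γ.Adj i j) a, modelMap M h (frame M x k i a) =
      ∑ a', inner ℂ (frame M x k j a') (modelMap M h (frame M x k i a)) • frame M x k j a'}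

variable {M} in
theorem isPolyFun_inner {σ : Type*} {i : I} {f g : (σ → ℝ) → Model M i}
    (hf : ∀ c, IsPolyFun fun x => f x c) (hg : ∀ c, IsPolyFun fun x => g x c) :
    IsPolyFun fun x => inner ℂ (f x) (g x) := by
  simp only [PiLp.inner_apply, RCLike.inner_apply]
  exact .sum fun c _ => (hg c).mul (hf c).conj

variable {M} in
theorem isPolyFun_modelMap {σ : Type*} {i j : I} (h : Γ.Adj i j) {f : (σ → ℝ) → Model M i}
    (hf : ∀ c, IsPolyFun fun x => f x c) (c) : IsPolyFun fun x => modelMap M h (f x) c := by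
  have : ∀ x, modelMap M h (f x) c =
      ∑ c', f x c' * modelMap M h (EuclideanSpace.single c' 1) c := by
    intro x
    have hx : f x = ∑ c', f x c' • EuclideanSpace.single c' (1 : ℂ) := by
      ext c
      simp [Finset.sum_apply, Pi.single_apply]
    conv_lhs => rw [hx, map_sum]
    simp
  simp only [this]
  exact .sum fun c' _ => (hf c').mul (.const _)

variable {M} in
theorem isPolyFun_proj {σ : Type*} {i : I} {m : ℕ} {b : Fin m → (σ → ℝ) → Model M i}
    {f : (σ → ℝ) → Model M i} (hb : ∀ a c, IsPolyFun fun x => b a x c)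
    (hf : ∀ c, IsPolyFun fun x => f x c) (c) :
    IsPolyFun fun x => (∑ a, inner ℂ (b a x) (f x) • b a x) c := by
  simp only [WithLp.ofLp_sum, Finset.sum_apply, PiLp.smul_apply, smul_eq_mul]
  exact .sum fun a _ => (isPolyFun_inner (hb a) hf).mul (hb a c)

theorem isPolyFun_frame (k : J) (i : I) (a : Fin (d k i)) (c) :
    IsPolyFun fun x : FrameIndex M d → ℝ => frame M x k i a c :=
  .mk_coord _ _

theorem linearIndependent_frame {x : FrameIndex M d → ℝ} {k : J} {i : I}
    (hx : Orthonormal ℂ (frame M x k i)) :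
    LinearIndependent ℂ fun a => (modelEquiv M i).symm (frame M x k i a) :=
  hx.linearIndependent.map' _ (modelEquiv M i).symm.ker

theorem map_mem_span_of_modelMap_mem {i j : I} (h : Γ.Adj i j) {m n : ℕ} {b : Fin m → Model M i}
    {b' : Fin n → Model M j}
    (hb : ∀ a, modelMap M h (b a) ∈ Submodule.span ℂ (Set.range b')) {v : M.V i}
    (hv : v ∈ Submodule.span ℂ (Set.range fun a => (modelEquiv M i).symm (b a))) :
    M.map h v ∈ Submodule.span ℂ (Set.range fun a => (modelEquiv M j).symm (b' a)) := by
  induction hv using Submodule.span_induction with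
  | mem v hv =>
    obtain ⟨a, rfl⟩ := hv
    exact (mem_span_modelEquiv_symm M _ _).2 (hb a)
  | zero => rw [map_zero]; exact Submodule.zero_mem _
  | add v w _ _ hv hw => rw [map_add]; exact Submodule.add_mem _ hv hw
  | smul c v _ hv => rw [map_smul]; exact Submodule.smul_mem _ _ hv

/-- The subspaces spanned by frames. -/
def frameSpan (x : FrameIndex M d → ℝ) (k : J) (i : I) : Submodule ℂ (M.V i) :=
  Submodule.span ℂ (Set.range fun a => (modelEquiv M i).symm (frame M x k i a))

theorem mem_frameSpan_iff {x : FrameIndex M d → ℝ} {k : J} {i : I} (v : M.V i) :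
    v ∈ frameSpan M x k i ↔ modelEquiv M i v ∈ Submodule.span ℂ (Set.range (frame M x k i)) :=
  mem_span_modelEquiv_symm M _ _

theorem frameSpan_le_iff {x : FrameIndex M d → ℝ} {k : J} {i : I} {S : Submodule ℂ (M.V i)} :
    frameSpan M x k i ≤ S ↔ ∀ a, (modelEquiv M i).symm (frame M x k i a) ∈ S := by
  rw [frameSpan, Submodule.span_le, Set.range_subset_iff]
  rfl

theorem map_mem_frameSpan [Preorder J] {x : FrameIndex M d → ℝ} (hx : x ∈ frameChains M d) (k : J)
    {i j : I} (h : Γ.Adj i j) (v : M.V i) (hv : v ∈ frameSpan M x k i) :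
    M.map h v ∈ frameSpan M x k j :=
  map_mem_span_of_modelMap_mem M h (b := frame M x k i) (b' := frame M x k j)
    (fun a => (mem_span_range_iff_of_orthonormal (hx.1 k j) _).2 (hx.2.2 k i j h a)) hv

/-- The submodules spanned by frames. -/
def frameSubRep [Preorder J] (x : frameChains M d) (k : J) : SubRep M :=
  ⟨frameSpan M x.1 k, fun h v hv => map_mem_frameSpan M x.2 k h v hv⟩

theorem frameSubRep_mem [Preorder J] (x : frameChains M d) :
    frameSubRep M x ∈ dimChains M d := by
  refine ⟨fun k l hkl i => ?_, fun k => funext fun i => ?_⟩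
  · change frameSpan M x.1 k i ≤ frameSpan M x.1 l i
    refine (frameSpan_le_iff M).2 fun a => ?_
    rw [mem_frameSpan_iff, LinearEquiv.apply_symm_apply]
    exact (mem_span_range_iff_of_orthonormal (x.2.1 l i) _).2 (x.2.2.1 k l hkl i a)
  · change Module.finrank ℂ (frameSpan M x.1 k i) = _
    rw [frameSpan, finrank_span_eq_card (linearIndependent_frame M (x.2.1 k i)), Fintype.card_fin]

/-- The topology on subspaces is coinduced from independent tuples, so it suffices that the spanning
tuple depends continuously on its coordinates. -/
theorem continuous_frameSubRep [Preorder J] :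
    Continuous fun x : frameChains M d => frameSubRep M x := by
  refine continuous_pi fun k => ?_
  let : ∀ i, TopologicalSpace (Submodule ℂ (M.V i)) := fun i => grassmannTopology (M.V i)
  refine continuous_induced_rng.2 (continuous_pi fun i => ?_)
  let : TopologicalSpace (M.V i) := moduleTopology ℂ (M.V i)
  have : IsModuleTopology ℂ (M.V i) := ⟨rfl⟩
  have := IsModuleTopology.toContinuousAdd ℂ (M.V i)
  have := IsModuleTopology.toContinuousSMul ℂ (M.V i)
  let e : (Fin (Module.finrank ℂ (M.V i)) → ℂ) →ₗ[ℂ] M.V i :=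
    (modelEquiv M i).symm.toLinearMap ∘ₗ (WithLp.linearEquiv 2 ℂ _).symm.toLinearMap
  have he : Continuous e := IsModuleTopology.continuous_of_linearMap e
  have h1 : Continuous fun x : frameChains M d => (⟨d k i,
      ⟨fun a => (modelEquiv M i).symm (frame M x.1 k i a), linearIndependent_frame M (x.2.1 k i)⟩⟩ :
      Σ m : ℕ, {b : Fin m → M.V i // LinearIndependent ℂ b}) := by
    refine continuous_sigmaMk.comp (Continuous.subtype_mk (continuous_pi fun a => ?_) _)
    have h2 : Continuous fun x : frameChains M d =>
        (fun c => ⟨x.1 ⟨k, i, a, c, false⟩, x.1 ⟨k, i, a, c, true⟩⟩ :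
          Fin (Module.finrank ℂ (M.V i)) → ℂ) := by
      refine continuous_pi fun c => ?_
      refine Complex.equivRealProdCLM.symm.continuous.comp (?_ : Continuous fun x : frameChains M d =>
        (x.1 ⟨k, i, a, c, false⟩, x.1 ⟨k, i, a, c, true⟩))
      exact ((continuous_apply _).comp continuous_subtype_val).prodMk
        ((continuous_apply _).comp continuous_subtype_val)
    exact he.comp h2
  have h3 : @Continuous _ _ inferInstance (grassmannTopology (M.V i))
      fun b : Σ m : ℕ, {b : Fin m → M.V i // LinearIndependent ℂ b} =>
        Submodule.span ℂ (Set.range b.2.1) := continuous_coinduced_rng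
  exact @Continuous.comp _ _ _ _ _ (grassmannTopology (M.V i)) _ _ h3 h1

theorem exists_frameSubRep_eq [Preorder J] {N : J → SubRep M} (hN : N ∈ dimChains M d) :
    ∃ x : frameChains M d, frameSubRep M x = N := by
  have h1 : ∀ k i, ∃ b : Fin (d k i) → Model M i, Orthonormal ℂ b ∧
      Submodule.span ℂ (Set.range b) =
        ((N k).carrier i).map (modelEquiv M i).toLinearMap := fun k i => by
    refine exists_orthonormal_span_eq _ ?_
    rw [LinearEquiv.finrank_map_eq]
    exact congrFun (hN.2 k) i
  choose b hb hspan using h1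
  let x : FrameIndex M d → ℝ := fun p =>
    if p.2.2.2.2 then (b p.1 p.2.1 p.2.2.1 p.2.2.2.1).im else (b p.1 p.2.1 p.2.2.1 p.2.2.2.1).re
  have hx : ∀ k i, frame M x k i = b k i := fun k i => by
    funext a
    ext c
    simp [frame, x]
  have hmem : ∀ k i v, v ∈ (N k).carrier i ↔ modelEquiv M i v ∈
      Submodule.span ℂ (Set.range (b k i)) := fun k i v => by
    rw [hspan, Submodule.mem_map_equiv]
    simp
  have hbN : ∀ k i a, (modelEquiv M i).symm (b k i a) ∈ (N k).carrier i := fun k i a => by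
    rw [hmem, LinearEquiv.apply_symm_apply]
    exact Submodule.subset_span ⟨a, rfl⟩
  refine ⟨⟨x, fun k i => (hx k i).symm ▸ hb k i, fun k l hkl i a => ?_, fun k i j h a => ?_⟩, ?_⟩
  · rw [hx, hx]
    refine (mem_span_range_iff_of_orthonormal (hb l i) _).1 ?_
    have := (hmem l i _).1 (hN.1 hkl i (hbN k i a))
    rwa [LinearEquiv.apply_symm_apply] at this
  · rw [hx, hx]
    exact (mem_span_range_iff_of_orthonormal (hb k j) _).1
      ((hmem k j _).1 ((N k).stable h _ (hbN k i a)))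
  · funext k
    ext i v
    change v ∈ frameSpan M x k i ↔ _
    rw [mem_frameSpan_iff, hx, hmem]

variable [Finite I] [Finite J]

theorem isAlgebraicSet_frameChains [Preorder J] : IsAlgebraicSet (frameChains M d) := by
  have vec : ∀ {i : I} {f g : (FrameIndex M d → ℝ) → Model M i}, (∀ c, IsPolyFun fun x => f x c) →
      (∀ c, IsPolyFun fun x => g x c) → IsAlgebraicSet {x | f x = g x} := by
    intro i f g hf hg
    have : {x | f x = g x} = ⋂ c, {x | f x c = g x c} := by
      ext x
      simp [PiLp.ext_iff]
    rw [this]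
    exact .iInter fun c => (hf c).isAlgebraicSet_eq (hg c)
  have hfr := isPolyFun_frame M (d := d)
  have : frameChains M d =
      (⋂ (k) (i) (a) (a'), {x | inner ℂ (frame M x k i a) (frame M x k i a') =
        if a = a' then (1 : ℂ) else 0}) ∩
      ((⋂ (k) (l) (_ : k ≤ l) (i) (a), {x | frame M x k i a =
        ∑ a', inner ℂ (frame M x l i a') (frame M x k i a) • frame M x l i a'}) ∩
      ⋂ (k) (i) (j) (h : Γ.Adj i j) (a), {x | modelMap M h (frame M x k i a) =
        ∑ a', inner ℂ (frame M x k j a') (modelMap M h (frame M x k i a)) • frame M x k j a'}) := by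
    ext x
    simp only [frameChains, orthonormal_iff_ite, Set.mem_inter_iff, Set.mem_iInter, Set.mem_ofPred_eq]
  rw [this]
  refine .inter ?_ (.inter ?_ ?_)
  · exact .iInter fun k => .iInter fun i => .iInter fun a => .iInter fun a' =>
      (isPolyFun_inner (hfr k i a) (hfr k i a')).isAlgebraicSet_eq (.const _)
  · exact .iInter fun k => .iInter fun l => .iInter fun _ => .iInter fun i => .iInter fun a =>
      vec (hfr k i a) (isPolyFun_proj (hfr l i) (hfr k i a))
  · exact .iInter fun k => .iInter fun i => .iInter fun j => .iInter fun h => .iInter fun a =>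
      vec (isPolyFun_modelMap h (hfr k i a))
        (isPolyFun_proj (hfr k j) (isPolyFun_modelMap h (hfr k i a)))

/-- Unit vectors have coordinates of absolute value at most `1`. -/
theorem isCompact_frameChains [Preorder J] : IsCompact (frameChains M d) := by
  have := Fintype.ofFinite I
  have := Fintype.ofFinite J
  refine (isCompact_Icc (a := -1) (b := (1 : FrameIndex M d → ℝ))).of_isClosed_subset
    (isAlgebraicSet_frameChains M).isClosed fun x hx => ?_
  have key : ∀ p, |x p| ≤ 1 := by
    rintro ⟨k, i, a, c, t⟩
    have h1 : ‖frame M x k i a c‖ ≤ 1 := ((hx.1 k i).1 a) ▸ PiLp.norm_apply_le _ c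
    cases t
    · exact (Complex.abs_re_le_norm _).trans h1
    · exact (Complex.abs_im_le_norm _).trans h1
  exact ⟨fun p => (abs_le.1 (key p)).1, fun p => (abs_le.1 (key p)).2⟩

/-- The variety of chains of submodules with given dimensions has finitely many components. -/
theorem finite_connectedComponents_dimChains [Preorder J] :
    Finite (ConnectedComponents (dimChains M d)) := by
  classical
  have := Fintype.ofFinite I
  have := Fintype.ofFinite J
  have := (isAlgebraicSet_frameChains M (d := d)).finite_connectedComponents
    (isCompact_frameChains M)
  refine finite_connectedComponents_of_surjective
    (f := fun x : frameChains M d => (⟨frameSubRep M x, frameSubRep_mem M x⟩ : dimChains M d))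
    ((continuous_frameSubRep M).subtype_mk _) fun N => ?_
  obtain ⟨x, hx⟩ := exists_frameSubRep_eq M N.2
  exact ⟨x, Subtype.ext hx⟩

end Chains

/-! ### Splitting flag varieties by dimension vectors. -/

section DimensionChains

variable {I : Type v} {Γ : SimpleGraph I} (M : QuiverRep.{u} Γ)

/-- On tuples of independent vectors the dimension of the span is the length, which is constant on
each summand of the disjoint union. -/
theorem continuous_dim_apply (i : I) : Continuous fun N : SubRep M => N.dim i := by
  let : ∀ i, TopologicalSpace (Submodule ℂ (M.V i)) := fun i => grassmannTopology (M.V i)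
  have h1 : Continuous (SubRep.carrier : SubRep M → _) := continuous_induced_dom
  have h2 : @Continuous _ _ (grassmannTopology (M.V i)) _
      fun S : Submodule ℂ (M.V i) => Module.finrank ℂ S := by
    let : TopologicalSpace (M.V i) := moduleTopology ℂ (M.V i)
    refine continuous_coinduced_dom.2 ?_
    have : ((fun S : Submodule ℂ (M.V i) => Module.finrank ℂ S) ∘
        fun b : Σ k : ℕ, {b : Fin k → M.V i // LinearIndependent ℂ b} =>
          Submodule.span ℂ (Set.range b.2.1)) = Sigma.fst := by
      funext b
      simpa using finrank_span_eq_card b.2.2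
    rw [this]
    exact continuous_sigma fun k => continuous_const
  exact h2.comp ((continuous_apply i).comp h1)

theorem continuous_dim [Finite I] : Continuous (SubRep.dim : SubRep M → I → ℕ) :=
  continuous_pi fun i => continuous_dim_apply M i

variable {M} in
theorem SubRep.eq_of_le_of_dim_eq {N N' : SubRep M} (h : N ≤ N') (hd : N.dim = N'.dim) : N = N' := by
  ext1
  funext i
  exact Submodule.eq_of_le_of_finrank_eq (h i) (congrFun hd i)

variable {M} in
theorem SubRep.dim_mono {N N' : SubRep M} (h : N ≤ N') : N.dim ≤ N'.dim := fun i =>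
  Submodule.finrank_mono (h i)

theorem SubRep.bot_le' (N : SubRep M) : ⊥ ≤ N := fun i => (bot_le : (⊥ : Submodule ℂ (M.V i)) ≤ _)

theorem SubRep.le_top' (N : SubRep M) : N ≤ ⊤ := fun i => (le_top : _ ≤ (⊤ : Submodule ℂ (M.V i)))

theorem SubRep.dim_bot : (⊥ : SubRep M).dim = 0 := funext fun i => finrank_bot ℂ (M.V i)

theorem SubRep.dim_top : (⊤ : SubRep M).dim = dimVec M := funext fun i => finrank_top ℂ (M.V i)

variable {M} in
theorem SubRep.dim_eq_zero_iff {N : SubRep M} : N.dim = 0 ↔ N = ⊥ :=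
  ⟨fun h => (eq_of_le_of_dim_eq (bot_le' M N) ((dim_bot M).trans h.symm)).symm,
    fun h => h ▸ dim_bot M⟩

variable {M} in
theorem SubRep.dim_eq_dimVec_iff {N : SubRep M} : N.dim = dimVec M ↔ N = ⊤ :=
  ⟨fun h => eq_of_le_of_dim_eq (le_top' M N) (h.trans (dim_top M).symm), fun h => h ▸ dim_top M⟩

/-- Repetitions in a chain do not change its variety. -/
def dimChainsComp {J J' : Type w} [LinearOrder J] [LinearOrder J'] (β : J' → I → ℕ) {f : J → J'}
    (hf : Monotone f) (hs : Function.Surjective f) :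
    dimChains M β ≃ₜ dimChains M (β ∘ f) where
  toFun N := ⟨N.1 ∘ f, N.2.1.comp hf, fun k => N.2.2 (f k)⟩
  invFun N := ⟨N.1 ∘ Function.surjInv hs, fun k l hkl => by
      rcases hkl.eq_or_lt with rfl | h
      · exact le_rfl
      · refine N.2.1 (le_of_not_gt fun h' => ?_)
        have := hf h'.le
        rw [Function.surjInv_eq hs, Function.surjInv_eq hs] at this
        exact absurd h this.not_gt, fun k => by
      rw [Function.comp_apply, N.2.2, Function.comp_apply, Function.surjInv_eq hs]⟩
  left_inv N := by
    ext1
    funext k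
    exact congrArg N.1 (Function.surjInv_eq hs k)
  right_inv N := by
    ext1
    funext k
    have hk : f (Function.surjInv hs (f k)) = f k := Function.surjInv_eq hs _
    -- Two members of a chain with equal dimension vectors coincide, so one representative index in
    -- each fibre of `f` determines the whole chain.
    have hd : (N.1 (Function.surjInv hs (f k))).dim = (N.1 k).dim := by
      rw [N.2.2, N.2.2, Function.comp_apply, Function.comp_apply, hk]
    change N.1 (Function.surjInv hs (f k)) = N.1 k
    rcases le_total (Function.surjInv hs (f k)) k with h | h
    · exact SubRep.eq_of_le_of_dim_eq (N.2.1 h) hd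
    · exact (SubRep.eq_of_le_of_dim_eq (N.2.1 h) hd.symm).symm
  continuous_toFun := by
    refine Continuous.subtype_mk (continuous_pi fun k => ?_) _
    exact (continuous_apply (f k)).comp continuous_subtype_val
  continuous_invFun := by
    refine Continuous.subtype_mk (continuous_pi fun k => ?_) _
    exact (continuous_apply (Function.surjInv hs k)).comp continuous_subtype_val

/-- Dimension vectors of chains `0 = M⁰ ⊆ ⋯ ⊆ M^{n+1}` with `dim M^{n+1} = ν`. -/
def weakChains (ν : I → ℕ) (n : ℕ) : Set (Fin (n + 2) → I → ℕ) :=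
  {d | Monotone d ∧ d 0 = 0 ∧ d (Fin.last (n + 1)) = ν}

theorem finite_weakChains [Finite I] (ν : I → ℕ) (n : ℕ) : (weakChains ν n).Finite := by
  have := Fintype.ofFinite I
  classical
  refine (Set.finite_Icc (0 : Fin (n + 2) → I → ℕ) fun _ => ν).subset fun d hd => ⟨?_, fun k => ?_⟩
  · exact fun k i => Nat.zero_le _
  · exact hd.2.2 ▸ hd.1 (Fin.le_last k)

instance [Finite I] (ν : I → ℕ) (n : ℕ) : Finite (weakChains ν n) := finite_weakChains ν n

theorem mem_flagVariety_iff {n : ℕ} {μ : I → ℕ} {N : Fin (n + 2) → SubRep M} :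
    N ∈ flagVariety M n μ ↔ ∃ d ∈ weakChains (dimVec M) n,
      ∑ k : Fin n, d k.succ.castSucc = μ ∧ N ∈ dimChains M d := by
  constructor
  · rintro ⟨hN, h0, h1, hs⟩
    refine ⟨fun k => (N k).dim, ⟨fun k l h => SubRep.dim_mono (hN h), ?_, ?_⟩, hs, hN, fun _ => rfl⟩
    · exact (congrArg SubRep.dim h0).trans (SubRep.dim_bot M)
    · exact (congrArg SubRep.dim h1).trans (SubRep.dim_top M)
  · rintro ⟨d, ⟨-, h0, h1⟩, hs, hN, hd⟩
    refine ⟨hN, ?_, ?_, ?_⟩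
    · rw [← SubRep.dim_eq_zero_iff, hd, h0]
    · rw [← SubRep.dim_eq_dimVec_iff, hd, h1]
    · simpa only [hd] using hs

/-- Fixing all the dimension vectors cuts out a clopen subset, because `dim` is continuous into a
discrete space. Only finitely many sequences `d` occur, and each piece has finitely many components.
-/
theorem eulerChar_flagVariety [Finite I] (n : ℕ) (μ : I → ℕ) :
    eulerChar (flagVariety M n μ) =
      ∑ᶠ d : {d : weakChains (dimVec M) n // ∑ k : Fin n, d.1 k.succ.castSucc = μ},
        eulerChar (dimChains M d.1.1) := by
  have := Fintype.ofFinite {d : weakChains (dimVec M) n // ∑ k : Fin n, d.1 k.succ.castSucc = μ}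
  rw [finsum_eq_sum_of_fintype]
  let U : {d : weakChains (dimVec M) n // ∑ k : Fin n, d.1 k.succ.castSucc = μ} →
      Set (flagVariety M n μ) := fun d => {N | ∀ k, (N.1 k).dim = d.1.1 k}
  have hmem : ∀ d : {d : weakChains (dimVec M) n // ∑ k : Fin n, d.1 k.succ.castSucc = μ},
      ∀ N ∈ dimChains M d.1.1, N ∈ flagVariety M n μ := fun d N hN =>
    (mem_flagVariety_iff M).2 ⟨d.1.1, d.1.2, d.2, hN⟩
  let e : ∀ d, U d ≃ₜ dimChains M d.1.1 := fun d =>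
    { toFun := fun N => ⟨N.1.1, N.1.2.1, N.2⟩
      invFun := fun N => ⟨⟨N.1, hmem d N.1 N.2⟩, N.2.2⟩
      left_inv := fun _ => rfl
      right_inv := fun _ => rfl
      continuous_toFun := by fun_prop
      continuous_invFun := by fun_prop }
  rw [eulerChar_eq_sum (U := U)]
  · exact Finset.sum_congr rfl fun d _ => eulerChar_congr (e d)
  · intro d
    have : U d = ⋂ k, (fun N : flagVariety M n μ => (N.1 k).dim) ⁻¹' {d.1.1 k} := by
      ext N
      simp [U]
    rw [this]
    refine isClopen_iInter_of_finite fun k => (isClopen_discrete _).preimage ?_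
    exact (continuous_dim M).comp ((continuous_apply k).comp continuous_subtype_val)
  · intro d d' h
    refine Set.disjoint_left.2 fun N hN hN' => h ?_
    ext1; ext1
    funext k
    exact (hN k).symm.trans (hN' k)
  · refine Set.eq_univ_of_forall fun N => ?_
    obtain ⟨d, hd, hs, hN⟩ := (mem_flagVariety_iff M).1 N.2
    exact Set.mem_iUnion.2 ⟨⟨⟨d, hd⟩, hs⟩, hN.2⟩
  · intro d
    have := finite_connectedComponents_dimChains M (d := d.1.1)
    exact finite_connectedComponents_of_surjective (e d).symm.continuous (e d).symm.surjective

end DimensionChains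

/-! ### Composition series as chains with prescribed dimension vectors. -/

section CompositionSeries

variable {I : Type v} [DecidableEq I] {Γ : SimpleGraph I}

theorem content_take_succ (s : List I) (k : Fin s.length) :
    content (s.take (k + 1)) = content (s.take k) + Pi.single (s.get k) 1 := by
  rw [List.take_succ_eq_append_getElem k.2]
  simp only [content, List.map_append, List.sum_append, List.map_cons, List.map_nil,
    List.sum_singleton, List.get_eq_getElem]

theorem content_cons (i : I) (s : List I) : content (i :: s) = Pi.single i 1 + content s := rfl

theorem sum_content [Fintype I] (s : List I) : ∑ i, content s i = s.length := by
  induction s with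
  | nil => simp [content]
  | cons i s ih =>
    rw [content_cons]
    simp [Finset.sum_add_distrib, ih, add_comm]

omit [DecidableEq I] in
theorem finrank_subquotient (M : QuiverRep.{u} Γ) {N N' : SubRep M} (h : N ≤ N') (i : I) :
    Module.finrank ℂ ((SubRep.subquotient N N').V i) + N.dim i = N'.dim i := by
  have := Submodule.finrank_quotient_add_finrank ((N.carrier i).submoduleOf (N'.carrier i))
  rw [(Submodule.submoduleOfEquivOfLe (h i)).finrank_eq] at this
  exact this

/-- The graph has no loops, so a representation of dimension `αᵢ` has only zero structure maps and
is determined by its dimensions. -/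
theorem nonempty_repIso_simpleRep_iff (M : QuiverRep.{u} Γ) (i : I) :
    Nonempty (RepIso M (simpleRep Γ i)) ↔ dimVec M = Pi.single i 1 := by
  have hdim : ∀ j, Module.finrank ℂ ((simpleRep Γ i).V j) = (Pi.single i 1 : I → ℕ) j := by
    intro j
    change Module.finrank ℂ (Fin (if j = i then 1 else 0) → ℂ) = _
    rw [Module.finrank_fin_fun, Pi.single_apply]
  constructor
  · rintro ⟨e⟩
    funext j
    rw [← hdim]
    exact (e.equiv j).finrank_eq
  · intro h
    have h' : ∀ j, Module.finrank ℂ (M.V j) = Module.finrank ℂ ((simpleRep Γ i).V j) := fun j =>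
      (congrFun h j).trans (hdim j).symm
    refine ⟨⟨fun j => LinearEquiv.ofFinrankEq _ _ (h' j), fun {j k} hjk x => ?_⟩⟩
    have hz : ∀ j, j ≠ i → Subsingleton (M.V j) := fun j hj => by
      rw [← Module.finrank_zero_iff (R := ℂ)]
      exact (congrFun h j).trans (Pi.single_eq_of_ne hj _)
    have hmap : M.map hjk x = 0 := by
      by_cases hj : j = i
      · have := hz k fun hk => hjk.ne (hj.trans hk.symm)
        exact Subsingleton.elim _ _
      · have := hz j hj
        rw [Subsingleton.elim x 0, map_zero]
    rw [hmap, map_zero]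
    rfl

theorem compSeries_eq_dimChains (M : QuiverRep.{u} Γ) {s : List I} (hs : s ∈ Seq (dimVec M)) :
    compSeries M s = dimChains M fun k : Fin (s.length + 1) => content (s.take k) := by
  have hstep : ∀ {N : Fin (s.length + 1) → SubRep M}, Monotone N → ∀ k : Fin s.length,
      Nonempty (RepIso (SubRep.subquotient (N k.castSucc) (N k.succ)) (simpleRep Γ (s.get k))) ↔
        (N k.succ).dim = (N k.castSucc).dim + Pi.single (s.get k) 1 := by
    intro N hN k
    rw [nonempty_repIso_simpleRep_iff, funext_iff, funext_iff]
    refine forall_congr' fun i => ?_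
    have := finrank_subquotient M (hN k.castSucc_le_succ) i
    rw [Pi.add_apply, ← this, add_comm, add_right_inj]
    rfl
  ext N
  constructor
  · rintro ⟨hN, h0, -, h⟩
    refine ⟨hN, fun k => ?_⟩
    induction k using Fin.induction with
    | zero => rw [h0, SubRep.dim_bot]; rfl
    | succ k ih =>
      rw [(hstep hN k).1 (h k), ih]
      exact (content_take_succ s k).symm
  · rintro ⟨hN, hd⟩
    refine ⟨hN, ?_, ?_, fun k => (hstep hN k).2 ?_⟩
    · rw [← SubRep.dim_eq_zero_iff, hd]
      rfl
    · rw [← SubRep.dim_eq_dimVec_iff, hd]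
      exact (congrArg content s.take_length).trans hs
    · rw [hd, hd]
      exact content_take_succ s k

end CompositionSeries

/-! ### `ρ^∨(ν)` is the height of `ν`. -/

section RootSystem

variable {I : Type v} [Fintype I] [DecidableEq I] {Γ : SimpleGraph I} [DecidableRel Γ.Adj]

variable (Γ) in
/-- The Cartan form `(β, γ)` on the root lattice. -/
def cartanForm (β γ : I → ℤ) : ℤ := ∑ j, ∑ i, β j * cartan Γ j i * γ i

theorem cartanForm_eq_dotProduct (β γ : I → ℤ) :
    cartanForm Γ β γ = β ⬝ᵥ (cartan Γ).mulVec γ := by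
  simp [cartanForm, dotProduct, Matrix.mulVec, Finset.mul_sum, mul_assoc]

omit [Fintype I] in
theorem cartan_apply (i j : I) :
    cartan Γ i j = 2 * (if i = j then 1 else 0) - if Γ.Adj i j then 1 else 0 := by
  simp only [cartan, Matrix.sub_apply, Matrix.smul_apply, Matrix.one_apply,
    SimpleGraph.adjMatrix_apply, smul_eq_mul]

omit [Fintype I] in
theorem cartan_symm (i j : I) : cartan Γ i j = cartan Γ j i := by
  simp only [cartan_apply, Γ.adj_comm i j, eq_comm (a := i)]

theorem cartanForm_comm (β γ : I → ℤ) : cartanForm Γ β γ = cartanForm Γ γ β := by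
  unfold cartanForm
  rw [Finset.sum_comm]
  refine Finset.sum_congr rfl fun i _ => Finset.sum_congr rfl fun j _ => ?_
  rw [cartan_symm]
  ring

theorem cartanForm_add_left (β γ δ : I → ℤ) :
    cartanForm Γ (β + γ) δ = cartanForm Γ β δ + cartanForm Γ γ δ := by
  simp [cartanForm_eq_dotProduct, add_dotProduct]

theorem cartanForm_smul_left (c : ℤ) (β γ : I → ℤ) :
    cartanForm Γ (c • β) γ = c * cartanForm Γ β γ := by
  simp only [cartanForm_eq_dotProduct, smul_dotProduct, smul_eq_mul]

theorem cartanForm_sub_left (β γ δ : I → ℤ) :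
    cartanForm Γ (β - γ) δ = cartanForm Γ β δ - cartanForm Γ γ δ := by
  simp [cartanForm_eq_dotProduct, sub_dotProduct]

theorem cartanForm_sub_right (β γ δ : I → ℤ) :
    cartanForm Γ β (γ - δ) = cartanForm Γ β γ - cartanForm Γ β δ := by
  rw [cartanForm_comm, cartanForm_sub_left, cartanForm_comm, cartanForm_comm δ]

theorem cartanForm_smul_right (c : ℤ) (β γ : I → ℤ) :
    cartanForm Γ β (c • γ) = c * cartanForm Γ β γ := by
  rw [cartanForm_comm, cartanForm_smul_left, cartanForm_comm]

theorem cartanForm_single (β : I → ℤ) (i : I) :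
    cartanForm Γ β (Pi.single i 1) = ∑ j, β j * cartan Γ j i := by
  simp [cartanForm, Pi.single_apply]

omit [Fintype I] in
theorem cartan_self (i : I) : cartan Γ i i = 2 := by
  simp [cartan_apply]

theorem cartanForm_single_self (i : I) :
    cartanForm Γ (Pi.single i 1) (Pi.single i 1) = 2 := by
  rw [cartanForm_single]
  simp [Pi.single_apply, cartan_self]

omit [Fintype I] in
theorem cartan_nonpos {i j : I} (h : i ≠ j) : cartan Γ i j ≤ 0 := by
  rw [cartan_apply, if_neg h]
  split_ifs <;> simp

variable (Γ) in
/-- Simple reflections. -/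
def reflect (i : I) (β : I → ℤ) : I → ℤ := β - cartanForm Γ β (Pi.single i 1) • Pi.single i 1

theorem isCoroot_reflect (i : I) {β : I → ℤ} (h : IsCoroot Γ β) : IsCoroot Γ (reflect Γ i β) := by
  have := h.reflect i
  rw [← cartanForm_single] at this
  convert this using 1
  ext j
  simp [reflect, Pi.single_apply]

theorem cartanForm_reflect_self (i : I) (β : I → ℤ) :
    cartanForm Γ (reflect Γ i β) (reflect Γ i β) = cartanForm Γ β β := by
  simp only [reflect, cartanForm_sub_left, cartanForm_sub_right, cartanForm_smul_left,
    cartanForm_smul_right, cartanForm_single_self, cartanForm_comm (Pi.single i 1) β]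
  ring

theorem cartanForm_reflect_single (i : I) (β : I → ℤ) :
    cartanForm Γ (reflect Γ i β) (Pi.single i 1) = -cartanForm Γ β (Pi.single i 1) := by
  simp only [reflect, cartanForm_sub_left, cartanForm_smul_left, cartanForm_single_self]
  ring

theorem reflect_reflect (i : I) (β : I → ℤ) : reflect Γ i (reflect Γ i β) = β := by
  rw [reflect, cartanForm_reflect_single, reflect]
  simp

theorem cartanForm_self_of_isCoroot {β : I → ℤ} (h : IsCoroot Γ β) : cartanForm Γ β β = 2 := by
  induction h with
  | simple i => exact cartanForm_single_self i
  | reflect i β h ih =>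
    rw [← cartanForm_single]
    rw [← cartanForm_reflect_self i β] at ih
    convert ih using 2 <;>
    · ext j
      simp [reflect, Pi.single_apply]

/-- The diagonal entries are `2` and the form is symmetric. Evenness improves positivity to `(β, β)
≥ 2` for nonzero `β`. -/
theorem even_cartanForm_self (β : I → ℤ) : Even (cartanForm Γ β β) := by
  have hβ : β = ∑ i, β i • Pi.single i (1 : ℤ) := by
    ext j
    simp [Finset.sum_apply, Pi.single_apply]
  rw [hβ]
  generalize (Finset.univ : Finset I) = s
  induction s using Finset.induction_on with
  | empty => simp [cartanForm]
  | insert i s hi ih =>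
    rw [Finset.sum_insert hi]
    generalize ∑ i ∈ s, β i • Pi.single i (1 : ℤ) = T at ih ⊢
    obtain ⟨a, ha⟩ := ih
    refine ⟨β i * β i + a + cartanForm Γ (β i • Pi.single i 1) T, ?_⟩
    rw [cartanForm_add_left, cartanForm_comm _ (_ + _), cartanForm_comm _ (_ + _),
      cartanForm_add_left, cartanForm_add_left, ha, cartanForm_comm T,
      cartanForm_smul_left (β i) _ (β i • Pi.single i 1), cartanForm_smul_right,
      cartanForm_single_self]
    ring

theorem cartanForm_pos (hΓ : IsSimplyLacedDynkin Γ) {β : I → ℤ} (h : β ≠ 0) :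
    0 < cartanForm Γ β β := by
  have h1 := hΓ.posDef.dotProduct_mulVec_pos (x := fun i => (β i : ℝ)) (by
    intro h0
    exact h (funext fun i => by simpa using congrFun h0 i))
  have h2 : (star fun i => (β i : ℝ)) ⬝ᵥ
      ((cartan Γ).map fun a : ℤ => (a : ℝ)).mulVec (fun i => (β i : ℝ)) =
      (cartanForm Γ β β : ℝ) := by
    simp [cartanForm, dotProduct, Matrix.mulVec, Finset.mul_sum, mul_assoc]
  rw [h2] at h1
  exact_mod_cast h1

/-- Split `β = p - q` into positive and negative parts. Disjoint supports give `(p, q) ≤ 0`, so if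
both parts were nonzero then `(β, β) ≥ 2 + 2`, against `(β, β) = 2`. -/
theorem isCoroot_nonneg_or_nonpos (hΓ : IsSimplyLacedDynkin Γ) {β : I → ℤ} (h : IsCoroot Γ β) :
    0 ≤ β ∨ β ≤ 0 := by
  have hβ := cartanForm_self_of_isCoroot h
  set p : I → ℤ := β⁺ with hp
  set q : I → ℤ := β⁻ with hq
  have hpq : β = p - q := (posPart_sub_negPart β).symm
  have hcross : cartanForm Γ p q ≤ 0 := by
    refine Finset.sum_nonpos fun j _ => Finset.sum_nonpos fun i _ => ?_
    by_cases hij : j = i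
    · subst hij
      have : p j * q j = 0 := by
        simp only [hp, hq, Pi.posPart_apply, Pi.negPart_apply]
        rcases le_total 0 (β j) with h0 | h0
        · rw [negPart_eq_zero.2 h0, mul_zero]
        · rw [posPart_eq_zero.2 h0, zero_mul]
      rw [mul_right_comm, this, zero_mul]
    · have h1 : 0 ≤ p j := by simp [hp]
      have h2 : 0 ≤ q i := by simp [hq]
      exact mul_nonpos_of_nonpos_of_nonneg
        (mul_nonpos_of_nonneg_of_nonpos h1 (cartan_nonpos hij)) h2
  have hexp : cartanForm Γ β β = cartanForm Γ p p + cartanForm Γ q q - 2 * cartanForm Γ p q := by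
    rw [hpq, cartanForm_sub_left, cartanForm_sub_right, cartanForm_sub_right, cartanForm_comm q p]
    ring
  by_cases hp0 : p = 0
  · right
    exact posPart_eq_zero.1 hp0
  by_cases hq0 : q = 0
  · left
    exact negPart_eq_zero.1 hq0
  exfalso
  have h1 := cartanForm_pos hΓ hp0
  have h2 := cartanForm_pos hΓ hq0
  obtain ⟨a, ha⟩ := even_cartanForm_self (Γ := Γ) p
  obtain ⟨b, hb⟩ := even_cartanForm_self (Γ := Γ) q
  omega

/-- Coroots are integral points with `(β, β) = 2`. Positive definiteness, through its minimum `c` on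
the unit sphere and homogeneity, confines them to a bounded box. -/
theorem finite_coroots (hΓ : IsSimplyLacedDynkin Γ) : {β : I → ℤ | IsCoroot Γ β}.Finite := by
  let Q : (I → ℝ) → ℝ := fun x => x ⬝ᵥ ((cartan Γ).map fun a : ℤ => (a : ℝ)).mulVec x
  have hQ : Continuous Q := by
    unfold Q dotProduct Matrix.mulVec dotProduct
    fun_prop
  obtain ⟨c, hc, hcQ⟩ := (isCompact_sphere (0 : I → ℝ) 1).exists_forall_le' (a := 0) hQ.continuousOn
    fun x hx => by
      have hx0 : x ≠ 0 := by
        rintro rfl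
        simp at hx
      simpa using hΓ.posDef.dotProduct_mulVec_pos hx0
  have hbound : ∀ x : I → ℝ, c * ‖x‖ ^ 2 ≤ Q x := by
    intro x
    by_cases hx : x = 0
    · simp [hx, Q]
    have hn : ‖x‖ ≠ 0 := norm_ne_zero_iff.2 hx
    have h1 := hcQ (‖x‖⁻¹ • x) (by simp [norm_smul, hn])
    have h2 : Q (‖x‖⁻¹ • x) = (‖x‖ ^ 2)⁻¹ * Q x := by
      simp only [Q, smul_dotProduct, Matrix.mulVec_smul, dotProduct_smul, smul_eq_mul]
      ring
    rw [h2, inv_mul_eq_div, le_div_iff₀ (by positivity)] at h1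
    exact h1
  obtain ⟨R, hR⟩ := exists_nat_gt (2 / c)
  refine (Set.finite_Icc (fun _ : I => -(R : ℤ) - 1) fun _ => (R : ℤ) + 1).subset fun β hβ => ?_
  have h2 : Q (fun i => (β i : ℝ)) = (cartanForm Γ β β : ℝ) := by
    simp [Q, cartanForm, dotProduct, Matrix.mulVec, Finset.mul_sum, mul_assoc]
  rw [cartanForm_self_of_isCoroot hβ] at h2
  have h3 := hbound fun i => (β i : ℝ)
  rw [h2, ← le_div_iff₀' hc] at h3
  -- From `|β i| ^ 2 ≤ 2 / c < R` the crude bound `R + 1` follows without a square root.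
  have h4 : ∀ i, |β i| ≤ R + 1 := by
    intro i
    have h5 : |(β i : ℝ)| ≤ ‖fun i => (β i : ℝ)‖ := norm_le_pi_norm (fun i => (β i : ℝ)) i
    have h6 : |(β i : ℝ)| ≤ R + 1 := by
      push_cast at h3
      nlinarith [abs_nonneg (β i : ℝ)]
    exact_mod_cast h6
  exact ⟨fun i => (sub_eq_add_neg (-(R : ℤ)) 1 ▸ neg_add (R : ℤ) 1 ▸ (abs_le.1 (h4 i)).1), fun i => (abs_le.1 (h4 i)).2⟩

variable (Γ) in
/-- Positive coroots. -/
def posCoroots : Set (I → ℤ) := {β | IsCoroot Γ β ∧ 0 ≤ β}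

/-- The reflection changes only the `i`-th coordinate. Were the result nonpositive, `β` would be
supported at `i`, and its norm would force `β` to be the simple coroot. -/
theorem reflect_mem_posCoroots (hΓ : IsSimplyLacedDynkin Γ) (i : I) {β : I → ℤ}
    (h : β ∈ posCoroots Γ) (hne : β ≠ Pi.single i 1) : reflect Γ i β ∈ posCoroots Γ := by
  have hr := isCoroot_reflect i h.1
  refine ⟨hr, (isCoroot_nonneg_or_nonpos hΓ hr).resolve_right fun hneg => hne ?_⟩
  have h0 : ∀ j, j ≠ i → β j = 0 := fun j hj => by
    have h1 := hneg j
    simp only [reflect, Pi.sub_apply, Pi.smul_apply, Pi.single_eq_of_ne hj, smul_zero, sub_zero,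
      Pi.zero_apply] at h1
    exact le_antisymm h1 (h.2 j)
  have hβ : β = β i • Pi.single i (1 : ℤ) := by
    ext j
    by_cases hj : j = i
    · subst hj; simp
    · simp [h0 j hj, hj]
  have h2 := cartanForm_self_of_isCoroot h.1
  rw [hβ, cartanForm_smul_left, cartanForm_smul_right, cartanForm_single_self] at h2
  have h3 : β i * β i = 1 := by linarith
  have h4 : β i = 1 := by
    rcases mul_self_eq_one_iff.1 h3 with h' | h'
    · exact h'
    · have := h.2 i
      simp [h'] at this
  rw [hβ, h4, one_smul]

/-- The simple reflection permutes the positive coroots other than `αᵢ^∨` and changes the sign of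
their pairing with `αᵢ`, so these cancel and `⟨αᵢ^∨, αᵢ⟩ = 2` remains. -/
theorem sum_posCoroots_single (hΓ : IsSimplyLacedDynkin Γ) (i : I) :
    ∑ β ∈ ((finite_coroots hΓ).subset fun _ h => h.1 : (posCoroots Γ).Finite).toFinset,
      cartanForm Γ β (Pi.single i 1) = 2 := by
  set S := ((finite_coroots hΓ).subset fun _ h => h.1 : (posCoroots Γ).Finite).toFinset
  have hS : ∀ β, β ∈ S ↔ β ∈ posCoroots Γ := fun β => Set.Finite.mem_toFinset _
  have hi : Pi.single i 1 ∈ S := (hS _).2 ⟨.simple i, Pi.single_nonneg.2 zero_le_one⟩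
  rw [← Finset.add_sum_erase _ _ hi, cartanForm_single_self]
  have hmaps : ∀ β ∈ S.erase (Pi.single i 1), reflect Γ i β ∈ S.erase (Pi.single i 1) := by
    intro β hβ
    rw [Finset.mem_erase, hS] at hβ ⊢
    refine ⟨fun h => ?_, reflect_mem_posCoroots hΓ i hβ.2 hβ.1⟩
    have h1 := reflect_reflect (Γ := Γ) i β
    rw [h, reflect, cartanForm_single_self] at h1
    have h2 := hβ.2.2 i
    rw [← h1] at h2
    simp at h2
  have hsum : ∑ β ∈ S.erase (Pi.single i 1), cartanForm Γ β (Pi.single i 1) =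
      ∑ β ∈ S.erase (Pi.single i 1), -cartanForm Γ β (Pi.single i 1) :=
    Finset.sum_nbij' (reflect Γ i) (reflect Γ i) hmaps hmaps (fun β _ => reflect_reflect i β)
      (fun β _ => reflect_reflect i β) fun β _ => by rw [cartanForm_reflect_single, neg_neg]
  rw [Finset.sum_neg_distrib] at hsum
  omega

theorem rhoCheck_eq (hΓ : IsSimplyLacedDynkin Γ) (ν : I → ℕ) :
    rhoCheck Γ ν = ((∑ i, ν i : ℕ) : ℝ) := by
  have hfin : (posCoroots Γ).Finite := (finite_coroots hΓ).subset fun _ h => h.1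
  have h1 : ∀ β : I → ℤ, cartanForm Γ β (fun i => (ν i : ℤ)) =
      ∑ i, (ν i : ℤ) * cartanForm Γ β (Pi.single i 1) := by
    intro β
    simp_rw [cartanForm_single, Finset.mul_sum]
    rw [Finset.sum_comm]
    exact Finset.sum_congr rfl fun j _ => Finset.sum_congr rfl fun i _ => by ring
  have h2 : ∑ β ∈ hfin.toFinset, cartanForm Γ β (fun i => (ν i : ℤ)) = 2 * ∑ i, (ν i : ℤ) := by
    simp_rw [h1]
    rw [Finset.sum_comm]
    simp_rw [← Finset.mul_sum, sum_posCoroots_single hΓ]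
    rw [← Finset.sum_mul, mul_comm]
  have h0 : rhoCheck Γ ν = (1 / 2) * ∑ᶠ β ∈ posCoroots Γ,
      (cartanForm Γ β (fun i => (ν i : ℤ)) : ℝ) := rfl
  rw [h0, finsum_mem_eq_finite_toFinset_sum _ hfin, ← Int.cast_sum]
  have h3 := congrArg (fun z : ℤ => (1 / 2 : ℝ) * (z : ℝ)) h2
  refine h3.trans ?_
  push_cast
  ring

end RootSystem

/-! ### Monotone surjections as lattice points, and Riemann sums. -/

section MonotoneSurjections

open scoped Pointwise

/-- Monotone surjections `Fin n → Fin r`. -/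
def MonoSurj (n r : ℕ) : Type := {f : Fin n → Fin r // Monotone f ∧ Function.Surjective f}

instance (n r : ℕ) : Finite (MonoSurj n r) := Subtype.finite

instance (n r : ℕ) : Fintype (MonoSurj n r) := Fintype.ofFinite _

/-- The list of values of a monotone map is sorted, hence determined by its multiset. -/
theorem eq_of_monotone_of_card_fiber_eq {n r : ℕ} {f g : Fin n → Fin r} (hf : Monotone f)
    (hg : Monotone g) (h : ∀ j, (Finset.univ.filter fun k => f k = j).card =
      (Finset.univ.filter fun k => g k = j).card) : f = g := by
  apply List.ofFn_injective
  refine List.Perm.eq_of_pairwise' hf.sortedLE_ofFn.pairwise hg.sortedLE_ofFn.pairwise ?_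
  rw [← Multiset.coe_eq_coe, ← Fin.univ_val_map, ← Fin.univ_val_map]
  ext j
  rw [Multiset.count_map, Multiset.count_map]
  simpa [Finset.card, eq_comm] using h j

theorem exists_monotone_card_fiber_eq {n r : ℕ} (a : Fin r → ℕ) (ha : ∑ j, a j = n) :
    ∃ f : Fin n → Fin r, Monotone f ∧ ∀ j, (Finset.univ.filter fun k => f k = j).card = a j := by
  let s : Multiset (Fin r) := ∑ j, a j • {j}
  have hs : (s.sort).length = n := by simp [s, ha]
  subst hs
  refine ⟨(s.sort).get, (s.pairwise_sort (· ≤ ·)).sortedLE.monotone_get, fun j => ?_⟩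
  have h1 : (Multiset.map (s.sort).get Finset.univ.val).count j = a j := by
    rw [Fin.univ_val_map, List.ofFn_get, Multiset.sort_eq]
    simp [s, Multiset.count_sum', Multiset.count_singleton]
  rw [← h1, Multiset.count_map]
  simp [Finset.card, eq_comm]

/-- The number of interior points in a fibre. -/
def gap {n r : ℕ} (f : Fin (n + 2) → Fin (r + 1)) (j : Fin (r + 1)) : ℕ :=
  (Finset.univ.filter fun k : Fin n => f k.succ.castSucc = j).card

theorem sum_gap {n r : ℕ} (f : Fin (n + 2) → Fin (r + 1)) : ∑ j, gap f j = n := by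
  have := Finset.card_eq_sum_card_fiberwise (s := (Finset.univ : Finset (Fin n)))
    (t := Finset.univ) (f := fun k : Fin n => f k.succ.castSucc) (by simp)
  rw [Finset.card_univ, Fintype.card_fin] at this
  exact this.symm

theorem sum_comp_eq_sum_gap {n r : ℕ} {E : Type*} [AddCommMonoid E]
    (f : Fin (n + 2) → Fin (r + 1)) (β : Fin (r + 1) → E) :
    ∑ k : Fin n, β (f k.succ.castSucc) = ∑ j, gap f j • β j := by
  rw [← Finset.sum_fiberwise Finset.univ fun k : Fin n => f k.succ.castSucc]
  refine Finset.sum_congr rfl fun j _ => ?_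
  rw [gap, ← Finset.sum_const]
  exact Finset.sum_congr rfl fun k hk => by rw [(Finset.mem_filter.1 hk).2]

/-- `gap` ignores the two end indices `0` and `n + 1`; they are restored here, both in the same
fibre when `r = 0`. -/
theorem card_fiber_eq {n r : ℕ} {f : Fin (n + 2) → Fin (r + 1)} (h0 : f 0 = 0)
    (h1 : f (Fin.last (n + 1)) = Fin.last r) (j : Fin (r + 1)) :
    (Finset.univ.filter fun k => f k = j).card =
      gap f j + (if 0 = j then 1 else 0) + if Fin.last r = j then 1 else 0 := by
  rw [gap, Finset.card_filter, Finset.card_filter, Fin.sum_univ_castSucc, Fin.sum_univ_succ,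
    Fin.castSucc_zero, h0, h1]
  ring

theorem map_zero_of_monotone_surjective {n r : ℕ} {f : Fin (n + 1) → Fin (r + 1)}
    (hf : Monotone f) (hs : Function.Surjective f) : f 0 = 0 := by
  obtain ⟨k, hk⟩ := hs 0
  exact le_antisymm (hk ▸ hf (Fin.zero_le k)) (Fin.zero_le _)

theorem map_last_of_monotone_surjective {n r : ℕ} {f : Fin (n + 1) → Fin (r + 1)}
    (hf : Monotone f) (hs : Function.Surjective f) : f (Fin.last n) = Fin.last r := by
  obtain ⟨k, hk⟩ := hs (Fin.last r)
  exact le_antisymm (Fin.le_last _) (hk ▸ hf (Fin.le_last k))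

/-- The solid simplex with its facets `xⱼ = 0` removed, except for the last one. -/
def truncatedSimplex (r : ℕ) : Set (Fin r → ℝ) :=
  {x | (∀ j, 0 ≤ x j) ∧ (∀ j : Fin r, j.succ ≠ Fin.last r → 0 < x j) ∧ ∑ j, x j ≤ 1}

/-- The solid simplex. -/
def solidSimplex (r : ℕ) : Set (Fin r → ℝ) := {x | (∀ j, 0 ≤ x j) ∧ ∑ j, x j ≤ 1}

theorem convex_truncatedSimplex (r : ℕ) : Convex ℝ (truncatedSimplex r) := by
  have : truncatedSimplex r = (⋂ j, {x | 0 ≤ x j}) ∩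
      ((⋂ (j : Fin r) (_ : j.succ ≠ Fin.last r), {x | 0 < x j}) ∩ {x | ∑ j, x j ≤ 1}) := by
    ext x
    simp [truncatedSimplex]
  rw [this]
  refine .inter (convex_iInter fun j => ?_) (.inter (convex_iInter₂ fun j _ => ?_) ?_)
  · exact convex_halfSpace_ge (LinearMap.proj (R := ℝ) (φ := fun _ : Fin r => ℝ) j).isLinear 0
  · exact convex_halfSpace_gt (LinearMap.proj (R := ℝ) (φ := fun _ : Fin r => ℝ) j).isLinear 0
  · have := convex_halfSpace_le (∑ j, LinearMap.proj (R := ℝ) (φ := fun _ : Fin r => ℝ) j).isLinear 1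
    simpa using this

theorem measurableSet_truncatedSimplex (r : ℕ) : MeasurableSet (truncatedSimplex r) := by
  have : truncatedSimplex r = (⋂ j, {x | 0 ≤ x j}) ∩
      ((⋂ (j : Fin r) (_ : j.succ ≠ Fin.last r), {x | 0 < x j}) ∩ {x | ∑ j, x j ≤ 1}) := by
    ext x
    simp [truncatedSimplex]
  rw [this]
  refine .inter (.iInter fun j => ?_) (.inter (.iInter fun j => .iInter fun _ => ?_) ?_)
  · exact measurableSet_le measurable_const (measurable_pi_apply j)
  · exact measurableSet_lt measurable_const (measurable_pi_apply j)
  · exact measurableSet_le (by fun_prop) measurable_const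

theorem truncatedSimplex_ae_eq (r : ℕ) : truncatedSimplex r =ᵐ[volume] solidSimplex r := by
  have h : ∀ᵐ x : Fin r → ℝ, ∀ j, x j ≠ 0 := by
    rw [ae_all_iff]
    intro j
    exact Measure.ae_eval_ne (μ := fun _ : Fin r => (volume : Measure ℝ)) j 0
  filter_upwards [h] with x hx
  refine propext ⟨fun h => ⟨h.1, h.2.2⟩, fun h => ⟨h.1, fun j _ => (h.1 j).lt_of_ne' (hx j), h.2⟩⟩

theorem isBounded_truncatedSimplex (r : ℕ) : Bornology.IsBounded (truncatedSimplex r) := by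
  refine (Metric.isBounded_Icc (0 : Fin r → ℝ) 1).subset fun x hx => ⟨hx.1, fun j => ?_⟩
  exact (Finset.single_le_sum (fun k _ => hx.1 k) (Finset.mem_univ j)).trans hx.2.2

/-- The lattice point of a monotone surjection. -/
def gapPoint {n r : ℕ} (f : MonoSurj (n + 2) (r + 1)) (j : Fin r) : ℝ := gap f.1 j.succ / n

/-- Fibres over `0` and over the last point already contain an end index, so their gaps may vanish.
Any other fibre needs an interior index, hence the strict inequalities. The gap over `0` is dropped
since all gaps add up to `n`. -/
theorem gapPoint_mem {n r : ℕ} (hn : n ≠ 0) (f : MonoSurj (n + 2) (r + 1)) :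
    gapPoint f ∈ truncatedSimplex r ∩
      (n : ℝ)⁻¹ • (Submodule.span ℤ (Set.range (Pi.basisFun ℝ (Fin r))) : Set (Fin r → ℝ)) := by
  have hn' : (0 : ℝ) < n := Nat.cast_pos.2 (Nat.pos_of_ne_zero hn)
  have : NeZero n := ⟨hn⟩
  refine ⟨⟨fun j => by unfold gapPoint; positivity, fun j hj => ?_, ?_⟩,
    BoxIntegral.unitPartition.mem_smul_span_iff.2 fun j => ⟨gap f.1 j.succ, ?_⟩⟩
  · refine div_pos (Nat.cast_pos.2 ?_) hn'
    have h1 := card_fiber_eq (map_zero_of_monotone_surjective f.2.1 f.2.2)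
      (map_last_of_monotone_surjective f.2.1 f.2.2) j.succ
    rw [if_neg (Fin.succ_ne_zero j).symm, if_neg hj.symm] at h1
    obtain ⟨k, hk⟩ := f.2.2 j.succ
    have h2 : 0 < (Finset.univ.filter fun k => f.1 k = j.succ).card :=
      Finset.card_pos.2 ⟨k, by simpa using hk⟩
    omega
  · unfold gapPoint
    rw [← Finset.sum_div, div_le_one hn']
    have h1 := sum_gap f.1
    rw [Fin.sum_univ_succ] at h1
    exact_mod_cast (by omega : ∑ j : Fin r, gap f.1 j.succ ≤ n)
  · rw [gapPoint, mul_div_cancel₀ _ hn'.ne']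
    simp

theorem gapPoint_injective {n r : ℕ} (hn : n ≠ 0) :
    Function.Injective (gapPoint : MonoSurj (n + 2) (r + 1) → Fin r → ℝ) := by
  intro f g h
  have hn' : (n : ℝ) ≠ 0 := Nat.cast_ne_zero.2 hn
  have h1 : ∀ j : Fin r, gap f.1 j.succ = gap g.1 j.succ := fun j => by
    have := congrFun h j
    rw [gapPoint, gapPoint, div_left_inj' hn'] at this
    exact_mod_cast this
  have h2 : ∀ j, gap f.1 j = gap g.1 j := fun j => by
    refine Fin.cases ?_ h1 j
    have hf := sum_gap f.1
    have hg := sum_gap g.1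
    rw [Fin.sum_univ_succ] at hf hg
    rw [Finset.sum_congr rfl fun j _ => h1 j] at hf
    omega
  refine Subtype.ext (eq_of_monotone_of_card_fiber_eq f.2.1 g.2.1 fun j => ?_)
  rw [card_fiber_eq (map_zero_of_monotone_surjective f.2.1 f.2.2) (map_last_of_monotone_surjective f.2.1 f.2.2),
    card_fiber_eq (map_zero_of_monotone_surjective g.2.1 g.2.2) (map_last_of_monotone_surjective g.2.1 g.2.2), h2]

theorem exists_gapPoint_eq {n r : ℕ} (hn : n ≠ 0) {x : Fin r → ℝ}
    (hx : x ∈ truncatedSimplex r ∩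
      (n : ℝ)⁻¹ • (Submodule.span ℤ (Set.range (Pi.basisFun ℝ (Fin r))) : Set (Fin r → ℝ))) :
    ∃ f : MonoSurj (n + 2) (r + 1), gapPoint f = x := by
  have hn' : (0 : ℝ) < n := Nat.cast_pos.2 (Nat.pos_of_ne_zero hn)
  have : NeZero n := ⟨hn⟩
  have h1 := BoxIntegral.unitPartition.mem_smul_span_iff.1 hx.2
  have h2 : ∀ j, ∃ c : ℕ, (c : ℝ) = n * x j := fun j => by
    obtain ⟨z, hz⟩ := h1 j
    have hz0 : 0 ≤ z := by
      have : (0 : ℝ) ≤ z := by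
        have := mul_nonneg hn'.le (hx.1.1 j)
        rwa [← hz] at this
      exact_mod_cast this
    lift z to ℕ using hz0
    exact ⟨z, by simpa using hz⟩
  choose c hc using h2
  have hsum : ∑ j, c j ≤ n := by
    have : (∑ j, (c j : ℝ)) ≤ n := by
      simp_rw [hc, ← Finset.mul_sum]
      exact mul_le_of_le_one_right hn'.le hx.1.2.2
    exact_mod_cast this
  -- The gap over `0` is what is left of `n`; adding one for each end index then gives fibre sizes
  -- with sum `n + 2`.
  let c' : Fin (r + 1) → ℕ := Fin.cons (n - ∑ j, c j) c
  have hc' : ∑ j, c' j = n := by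
    rw [Fin.sum_univ_succ]
    simp only [c', Fin.cons_zero, Fin.cons_succ]
    omega
  obtain ⟨f, hf, hcard⟩ := exists_monotone_card_fiber_eq (n := n + 2)
    (fun j => c' j + (if 0 = j then 1 else 0) + if Fin.last r = j then 1 else 0) (by
      simp [Finset.sum_add_distrib, hc'])
  have hs : Function.Surjective f := fun j => by
    have : 0 < (Finset.univ.filter fun k => f k = j).card := by
      rw [hcard]
      refine Fin.cases (by simp) (fun j => ?_) j
      by_cases hj : j.succ = Fin.last r
      · rw [if_pos hj.symm]; omega
      · have h3 : (0 : ℝ) < c j := by rw [hc]; exact mul_pos hn' (hx.1.2.1 j hj)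
        have h4 : 0 < c j := by exact_mod_cast h3
        simp only [c', Fin.cons_succ]
        omega
    obtain ⟨k, hk⟩ := Finset.card_pos.1 this
    exact ⟨k, (Finset.mem_filter.1 hk).2⟩
  refine ⟨⟨f, hf, hs⟩, funext fun j => ?_⟩
  have h3 := card_fiber_eq (map_zero_of_monotone_surjective hf hs) (map_last_of_monotone_surjective hf hs) j.succ
  rw [hcard] at h3
  have h4 : gap f j.succ = c j := by
    have : c' j.succ = c j := rfl
    omega
  change (gap f j.succ : ℝ) / n = x j
  rw [div_eq_iff hn'.ne', h4, hc, mul_comm]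

/-- Riemann sums over the lattice points of the simplex. -/
theorem tendsto_sum_gapPoint (r : ℕ) {F : (Fin r → ℝ) → ℝ} (hF : Continuous F) :
    Tendsto (fun n : ℕ => (∑ f : MonoSurj (n + 2) (r + 1), F (gapPoint f)) / (n : ℝ) ^ r) atTop
      (𝓝 (∫ x in solidSimplex r, F x)) := by
  have h := tendsto_tsum_div_pow_atTop_integral (truncatedSimplex r) F hF
    (isBounded_truncatedSimplex r) (measurableSet_truncatedSimplex r)
    ((convex_truncatedSimplex r).addHaar_frontier volume)
  rw [setIntegral_congr_set (truncatedSimplex_ae_eq r)] at h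
  refine h.congr' ?_
  filter_upwards [eventually_ne_atTop 0] with n hn
  rw [Fintype.card_fin]
  congr 1
  -- For `n ≠ 0` the surjections are exactly the points of `(1/n)ℤ^r` in the truncated simplex, so
  -- the lattice sum becomes a sum over surjections.
  let e : MonoSurj (n + 2) (r + 1) ≃ ↑(truncatedSimplex r ∩
      (n : ℝ)⁻¹ • (Submodule.span ℤ (Set.range (Pi.basisFun ℝ (Fin r))) : Set (Fin r → ℝ))) :=
    Equiv.ofBijective (fun f => ⟨gapPoint f, gapPoint_mem hn f⟩)
      ⟨fun f g h => gapPoint_injective hn (congrArg Subtype.val h), fun x => by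
        obtain ⟨f, hf⟩ := exists_gapPoint_eq hn x.2
        exact ⟨f, Subtype.ext hf⟩⟩
  rw [← e.tsum_eq fun x => F x, tsum_fintype]
  rfl

end MonotoneSurjections

/-! ### Integration against multiples of positive measures. -/

section ComplexMeasures

/-- Reduces integrals against scaled `D_𝐢` and scaled Dirac masses to ordinary ones. The variation
is at most `‖z‖ ν`, so the integral is a `setToFun` over `ν`, and the formula extends from
indicators by linearity and density. -/
theorem integral_complexMeasure_of_apply_eq {X : Type*} [MeasurableSpace X] {ν : Measure X}
    [IsFiniteMeasure ν] {z : ℂ} {m : ComplexMeasure X}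
    (hm : ∀ s, MeasurableSet s → m s = ν.real s • z) {f : X → ℝ} (hf : Integrable f ν) :
    VectorMeasure.Integrable m f ∧ ∫ᵛ x, f x ∂•m = (∫ x, f x ∂ν) • z := by
  have hvar : m.variation ≤ ‖z‖₊ • ν := by
    refine VectorMeasure.variation_le_of_forall_enorm_le fun s hs => ?_
    rw [hm s hs, enorm_smul, Measure.smul_apply, Measure.real, Real.enorm_of_nonneg (by positivity),
      ENNReal.ofReal_toReal (by finiteness), mul_comm]
    rfl
  let T : Set X → ℝ →L[ℝ] ℂ := m.transpose (ContinuousLinearMap.lsmul ℝ ℝ)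
  have hTapply : ∀ s, MeasurableSet s → ∀ x, T s x = x • ν.real s • z := fun s hs x => by
    rw [← hm s hs]; rfl
  have hT : DominatedFinMeasAdditive ν T ‖z‖ := by
    refine ⟨fun s t hs ht _ _ hdisj => ?_, fun s hs _ => ?_⟩
    · ext1
      rw [add_apply, hTapply _ (hs.union ht), hTapply _ hs, hTapply _ ht,
        measureReal_union hdisj ht, add_smul, smul_add]
    · refine ContinuousLinearMap.opNorm_le_bound _ (by positivity) fun x => ?_
      rw [hTapply s hs, norm_smul, norm_smul, Real.norm_of_nonneg (measureReal_nonneg)]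
      exact le_of_eq (by ring)
  refine ⟨(hf.smul_measure_nnreal (c := ‖z‖₊)).mono_measure hvar, ?_⟩
  have h1 : ∫ᵛ x, f x ∂•m = setToFun ν T hT f :=
    (setToFun_congr_measure_of_integrable (‖z‖₊ : ENNReal) (by finiteness) hvar hT _ f hf).symm
  rw [h1]
  refine Integrable.induction (μ := ν)
    (fun f : X → ℝ => setToFun ν T hT f = (∫ x, f x ∂ν) • z) ?_ ?_ ?_ ?_ hf
  · intro c s hs hν
    rw [setToFun_indicator_const hT hs hν.ne, hTapply _ hs, integral_indicator_const _ hs,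
      smul_smul, smul_eq_mul, mul_comm]
  · intro f g _ hf hg hf' hg'
    rw [setToFun_add hT hf hg, hf', hg', integral_add' hf hg, add_smul]
  · exact isClosed_eq (continuous_setToFun hT) (continuous_integral.smul continuous_const)
  · intro f g hfg _ hf
    rw [← setToFun_congr_ae hT hfg, hf, integral_congr_ae hfg]

variable {I : Type v} [Fintype I]

/-- The image of a point of the solid simplex under the affine map with vertices `-β k`. -/
def simplexPoint {r : ℕ} (β : Fin (r + 1) → I → ℝ) (x : Fin r → ℝ) : I → ℝ :=
  -∑ k, (Fin.cons (1 - ∑ j, x j) x : Fin (r + 1) → ℝ) k • β k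

omit [Fintype I] in
theorem continuous_simplexPoint {r : ℕ} (β : Fin (r + 1) → I → ℝ) :
    Continuous (simplexPoint β) := by
  unfold simplexPoint
  simp only [Fin.sum_univ_succ (n := r), Fin.cons_zero, Fin.cons_succ]
  fun_prop

-- A value `β j` occurs `gap f j` times among the interior indices, so the numbers `gap f j / n` are
-- barycentric coordinates of the rescaled sum.
omit [Fintype I] in
theorem simplexPoint_gapPoint {n r : ℕ} (hn : n ≠ 0) (β : Fin (r + 1) → I → ℝ)
    (f : MonoSurj (n + 2) (r + 1)) :
    simplexPoint β (gapPoint f) = (1 / (n : ℝ)) • -∑ k : Fin n, β (f.1 k.succ.castSucc) := by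
  have hn' : (n : ℝ) ≠ 0 := Nat.cast_ne_zero.2 hn
  rw [sum_comp_eq_sum_gap, simplexPoint, smul_neg, Finset.smul_sum]
  congr 1
  refine Finset.sum_congr rfl fun j _ => ?_
  rw [← Nat.cast_smul_eq_nsmul ℝ, smul_smul]
  congr 1
  refine Fin.cases ?_ (fun j => ?_) j
  · have h := sum_gap f.1
    rw [Fin.sum_univ_succ] at h
    have h' : (gap f.1 0 : ℝ) + ∑ j : Fin r, (gap f.1 j.succ : ℝ) = n := by exact_mod_cast h
    simp only [Fin.cons_zero, gapPoint]
    rw [← Finset.sum_div]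
    field_simp
    linarith
  · simp only [Fin.cons_succ, gapPoint]
    ring

omit [Fintype I] in
/-- The limit of the contributions of the chains with the steps `β 0 < ⋯ < β r`. -/
theorem tendsto_sum_monoSurj {r : ℕ} (β : Fin (r + 1) → I → ℝ) {φ : (I → ℝ) → ℝ}
    (hφ : Continuous φ) :
    Tendsto (fun n : ℕ => (∑ f : MonoSurj (n + 2) (r + 1),
      φ ((1 / (n : ℝ)) • -∑ k : Fin n, β (f.1 k.succ.castSucc))) / (n : ℝ) ^ r) atTop
      (𝓝 (∫ x in solidSimplex r, φ (simplexPoint β x))) := by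
  refine (tendsto_sum_gapPoint r (hφ.comp (continuous_simplexPoint β))).congr' ?_
  filter_upwards [eventually_ne_atTop 0] with n hn
  congr 1
  refine Finset.sum_congr rfl fun f _ => ?_
  rw [Function.comp_apply, simplexPoint_gapPoint hn]

theorem isCompact_solidSimplex (r : ℕ) : IsCompact (solidSimplex r) := by
  refine (isCompact_Icc (a := 0) (b := (1 : Fin r → ℝ))).of_isClosed_subset ?_ fun x hx =>
    ⟨hx.1, fun j => (Finset.single_le_sum (fun k _ => hx.1 k) (Finset.mem_univ j)).trans hx.2⟩
  have : solidSimplex r = (⋂ j, {x | 0 ≤ x j}) ∩ {x | ∑ j, x j ≤ 1} := by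
    ext x
    simp [solidSimplex]
  rw [this]
  exact (isClosed_iInter fun j => isClosed_le continuous_const (continuous_apply j)).inter
    (isClosed_le (by fun_prop) continuous_const)

variable [DecidableEq I]

omit [Fintype I] in
theorem seqMeasure_eq_map (s : List I) :
    seqMeasure s = (volume.restrict (solidSimplex s.length)).map
      (simplexPoint fun k : Fin (s.length + 1) => toWeight (content (s.take k))) := by
  have h1 : Measurable fun c : Fin s.length → ℝ =>
      (Fin.cons (1 - ∑ k, c k) c : Fin (s.length + 1) → ℝ) := by
    refine measurable_pi_lambda _ fun k => ?_
    refine Fin.cases ?_ (fun k => ?_) k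
    · simp only [Fin.cons_zero]; fun_prop
    · simp only [Fin.cons_succ]; fun_prop
  have h2 : Measurable (piMap s) := by
    unfold piMap
    fun_prop
  rw [seqMeasure, simplexMeasure, Measure.map_map h2 h1]
  rfl

theorem integral_smul_seqComplexMeasure (z : ℂ) (s : List I) {φ : (I → ℝ) → ℝ}
    (hφ : Continuous φ) :
    VectorMeasure.Integrable (z • seqComplexMeasure s) φ ∧
      ∫ᵛ x, φ x ∂•(z • seqComplexMeasure s) = (∫ x in solidSimplex s.length,
        φ (simplexPoint (fun k : Fin (s.length + 1) => toWeight (content (s.take k))) x)) • z := by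
  have hc := continuous_simplexPoint fun k : Fin (s.length + 1) => toWeight (content (s.take k))
  have hφint : Integrable φ (seqMeasure s) := by
    rw [seqMeasure_eq_map, integrable_map_measure hφ.aestronglyMeasurable hc.aemeasurable]
    exact (hφ.comp hc).continuousOn.integrableOn_compact (isCompact_solidSimplex _)
  have key := integral_complexMeasure_of_apply_eq (ν := seqMeasure s) (z := z)
    (m := z • seqComplexMeasure s) (fun t ht => ?_) hφint
  · refine ⟨key.1, key.2.trans ?_⟩
    rw [seqMeasure_eq_map, integral_map hc.aemeasurable hφ.aestronglyMeasurable]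
  · have : seqComplexMeasure s t = ((seqMeasure s).real t : ℂ) := by
      rw [seqComplexMeasure, SignedMeasure.toComplexMeasure_apply,
        Measure.toSignedMeasure_apply_measurable ht]
      rfl
    rw [smul_apply, this, smul_eq_mul, Complex.real_smul, mul_comm]

end ComplexMeasures

/-! ### Weak chains as strict chains with repetitions; maximal chains as sequences. -/

section StrictChains

variable {I : Type v} [Fintype I]

/-- Strict chains `0 = β 0 < ⋯ < β r = ν`. -/
def StrictChain (ν : I → ℕ) (r : ℕ) : Type v :=
  {β : Fin (r + 1) → I → ℕ // StrictMono β ∧ β 0 = 0 ∧ β (Fin.last r) = ν}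

instance (ν : I → ℕ) (r : ℕ) : Finite (StrictChain ν r) := by
  classical
  refine ((Set.finite_Icc (0 : Fin (r + 1) → I → ℕ) fun _ => ν).subset fun d hd =>
    ⟨fun k i => Nat.zero_le _, fun k => ?_⟩ : {β : Fin (r + 1) → I → ℕ |
      StrictMono β ∧ β 0 = 0 ∧ β (Fin.last r) = ν}.Finite)
  exact hd.2.2 ▸ hd.1.monotone (Fin.le_last k)

instance (ν : I → ℕ) (r : ℕ) : Fintype (StrictChain ν r) := Fintype.ofFinite _

theorem sum_strictMono : StrictMono fun ν : I → ℕ => ∑ i, ν i := fun _ _ h =>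
  Fintype.sum_strictMono h

theorem eq_of_le_of_sum_eq {a b : I → ℕ} (h : a ≤ b) (hs : ∑ i, a i = ∑ i, b i) : a = b :=
  h.eq_or_lt.resolve_right fun hlt => (sum_strictMono hlt).ne hs

theorem exists_eq_add_single [DecidableEq I] {a b : I → ℕ} (h : a ≤ b)
    (hs : ∑ i, b i = ∑ i, a i + 1) : ∃ i, b = a + Pi.single i 1 := by
  obtain ⟨i, hi⟩ : ∃ i, a i < b i := by
    by_contra! h'
    have := Finset.sum_le_sum fun i (_ : i ∈ Finset.univ) => h' i
    omega
  refine ⟨i, (eq_of_le_of_sum_eq (fun j => ?_) ?_).symm⟩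
  · by_cases hj : j = i
    · subst hj
      simpa using hi
    · simpa [hj] using h j
  · simp [Finset.sum_add_distrib, hs]

/-- The height rises by at least one at each strict step. This bounds the length of a strict chain
and fixes all heights in one of maximal length. -/
theorem add_sum_le_sum {r : ℕ} {β : Fin (r + 1) → I → ℕ} (hβ : StrictMono β) {k l : Fin (r + 1)}
    (h : k ≤ l) : (l : ℕ) - k + ∑ i, β k i ≤ ∑ i, β l i := by
  induction l using Fin.induction with
  | zero =>
    obtain rfl : k = 0 := le_antisymm h (Fin.zero_le _)
    simp
  | succ l ih =>
    rcases h.eq_or_lt with rfl | h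
    · simp
    · have h1 := ih (Fin.le_castSucc_iff.2 h)
      have h2 := sum_strictMono (hβ l.castSucc_lt_succ)
      have h3 : (k : ℕ) < l + 1 := h
      simp only [Fin.val_succ, Fin.val_castSucc] at h1 h2 ⊢
      omega

theorem StrictChain.le_sum {ν : I → ℕ} {r : ℕ} (β : StrictChain ν r) : r ≤ ∑ i, ν i := by
  have := add_sum_le_sum β.2.1 (Fin.zero_le (Fin.last r))
  rw [β.2.2.2, β.2.2.1] at this
  simpa using this

theorem StrictChain.sum_eq {ν : I → ℕ} (β : StrictChain ν (∑ i, ν i)) (k : Fin (∑ i, ν i + 1)) :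
    ∑ i, β.1 k i = k := by
  have h1 := add_sum_le_sum β.2.1 (Fin.zero_le k)
  have h2 := add_sum_le_sum β.2.1 (Fin.le_last k)
  rw [β.2.2.2] at h2
  rw [β.2.2.1] at h1
  have := k.is_le
  simp at h1 h2
  omega

/-- The weak chain obtained from a strict chain by repetitions. -/
def repeatChain (ν : I → ℕ) (n : ℕ)
    (c : Σ r : Fin (∑ i, ν i + 1), StrictChain ν r × MonoSurj (n + 2) (r + 1)) :
    weakChains ν n :=
  ⟨c.2.1.1 ∘ c.2.2.1, c.2.1.2.1.monotone.comp c.2.2.2.1, by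
    rw [Function.comp_apply, map_zero_of_monotone_surjective c.2.2.2.1 c.2.2.2.2, c.2.1.2.2.1], by
    rw [Function.comp_apply, map_last_of_monotone_surjective c.2.2.2.1 c.2.2.2.2, c.2.1.2.2.2]⟩

/-- The strict chain is the increasing enumeration of the set of values, and injectivity of `β` then
recovers the surjection. -/
theorem repeatChain_injective (ν : I → ℕ) (n : ℕ) : Function.Injective (repeatChain ν n) := by
  rintro ⟨r, β, f⟩ ⟨r', β', f'⟩ h
  have h1 : β.1 ∘ f.1 = β'.1 ∘ f'.1 := congrArg Subtype.val h
  have h2 : Set.range β.1 = Set.range β'.1 := by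
    rw [← f.2.2.range_comp β.1, h1, f'.2.2.range_comp]
  have h3 : (r : ℕ) = r' := by
    have := congrArg Set.ncard h2
    rw [← Set.image_univ, ← Set.image_univ, Set.ncard_image_of_injective _ β.2.1.injective,
      Set.ncard_image_of_injective _ β'.2.1.injective] at this
    simpa using this
  obtain rfl : r = r' := Fin.ext h3
  obtain rfl : β = β' := Subtype.ext ((β.2.1.range_inj β'.2.1).1 h2)
  obtain rfl : f = f' := Subtype.ext (funext fun k => β.2.1.injective (congrFun h1 k))
  rfl

theorem repeatChain_surjective (ν : I → ℕ) (n : ℕ) : Function.Surjective (repeatChain ν n) := by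
  classical
  intro d
  -- Heights separate the values of a chain, so ranking the distinct heights yields the surjection
  -- `f`, and `d` factors through it.
  let σ : Fin (n + 2) → ℕ := fun k => ∑ i, d.1 k i
  have hσ : Monotone σ := fun k l h => Finset.sum_le_sum fun i _ => d.2.1 h i
  let S : Finset ℕ := Finset.univ.image σ
  have hmem : ∀ k, σ k ∈ S := fun k => Finset.mem_image_of_mem σ (Finset.mem_univ k)
  obtain ⟨r, hr⟩ : ∃ r, S.card = r + 1 :=
    Nat.exists_eq_succ_of_ne_zero (Finset.card_pos.2 ⟨_, hmem 0⟩).ne'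
  let e := S.orderIsoOfFin hr
  let f : Fin (n + 2) → Fin (r + 1) := fun k => e.symm ⟨σ k, hmem k⟩
  have hf : Monotone f := fun k l h => e.symm.monotone (hσ h)
  have hfs : Function.Surjective f := fun j => by
    obtain ⟨k, -, hk⟩ := Finset.mem_image.1 (e j).2
    exact ⟨k, by rw [OrderIso.symm_apply_eq]; exact Subtype.ext hk⟩
  have hfd : ∀ k l, f k = f l → d.1 k = d.1 l := fun k l h => by
    have h1 : σ k = σ l := congrArg Subtype.val (e.symm.injective h)
    rcases le_total k l with hkl | hkl
    · exact eq_of_le_of_sum_eq (d.2.1 hkl) h1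
    · exact (eq_of_le_of_sum_eq (d.2.1 hkl) h1.symm).symm
  let β : Fin (r + 1) → I → ℕ := fun j => d.1 (Function.surjInv hfs j)
  have hβf : ∀ k, β (f k) = d.1 k := fun k => hfd _ _ (Function.surjInv_eq hfs _)
  have hβ : StrictMono β := fun j j' h => by
    have h1 := Function.surjInv_eq hfs j
    have h2 := Function.surjInv_eq hfs j'
    have h3 : Function.surjInv hfs j < Function.surjInv hfs j' := by
      by_contra! h4
      have := hf h4
      rw [h1, h2] at this
      exact absurd h this.not_gt
    refine lt_of_le_of_ne (d.2.1 h3.le) fun h4 => h.ne ?_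
    rw [← h1, ← h2]
    exact congrArg e.symm (Subtype.ext (congrArg (fun ν : I → ℕ => ∑ i, ν i) h4))
  let B : StrictChain ν r := ⟨β, hβ, by
    rw [← map_zero_of_monotone_surjective hf hfs, hβf, d.2.2.1], by
    rw [← map_last_of_monotone_surjective hf hfs, hβf, d.2.2.2]⟩
  exact ⟨⟨⟨r, Nat.lt_succ_of_le B.le_sum⟩, B, f, hf, hfs⟩, Subtype.ext (funext hβf)⟩

theorem sum_weakChains {ν : I → ℕ} {n : ℕ} [Fintype (weakChains ν n)]
    (G : (Fin (n + 2) → I → ℕ) → ℂ) :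
    ∑ d : weakChains ν n, G d.1 = ∑ r : Fin (∑ i, ν i + 1), ∑ β : StrictChain ν r,
      ∑ f : MonoSurj (n + 2) (r + 1), G (β.1 ∘ f.1) := by
  have hb : Function.Bijective (repeatChain ν n) :=
    ⟨repeatChain_injective ν n, repeatChain_surjective ν n⟩
  rw [← hb.sum_comp fun d => G d.1, Fintype.sum_sigma]
  refine Finset.sum_congr rfl fun r _ => ?_
  rw [Fintype.sum_prod_type]
  rfl

variable [DecidableEq I]

theorem length_of_mem_Seq {ν : I → ℕ} {s : List I} (hs : s ∈ Seq ν) : s.length = ∑ i, ν i := by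
  rw [← sum_content, show content s = ν from hs]

theorem finite_Seq (ν : I → ℕ) : (Seq ν).Finite :=
  (List.finite_length_eq I (∑ i, ν i)).subset fun _ hs => length_of_mem_Seq hs

/-- The strict chain of partial sums of a sequence. -/
def seqChain (ν : I → ℕ) (s : Seq ν) : StrictChain ν (∑ i, ν i) :=
  ⟨fun k => content (s.1.take k), by
    refine Fin.strictMono_iff_lt_succ.2 fun k => ?_
    have hk : (k : ℕ) < s.1.length := by rw [length_of_mem_Seq s.2]; exact k.2
    have := content_take_succ s.1 ⟨k, hk⟩
    rw [Fin.val_succ, Fin.val_castSucc, this]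
    exact lt_add_of_pos_right _ (Pi.single_pos.2 one_pos), rfl, by
    change content (s.1.take (∑ i, ν i)) = ν
    rw [← length_of_mem_Seq s.2, List.take_length]
    exact s.2⟩

/-- Each step of a strict chain of maximal length raises the height by exactly one, so it adds a
single simple root; these roots form the sequence. -/
theorem seqChain_bijective (ν : I → ℕ) : Function.Bijective (seqChain ν) := by
  constructor
  · intro s s' h
    have hl := length_of_mem_Seq s.2
    have hl' := length_of_mem_Seq s'.2
    have h1 : ∀ k ≤ ∑ i, ν i, content (s.1.take k) = content (s'.1.take k) := fun k hk =>
      congrFun (congrArg Subtype.val h) ⟨k, Nat.lt_succ_of_le hk⟩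
    refine Subtype.ext (List.ext_get (hl.trans hl'.symm) fun k hk hk' => ?_)
    have h2 := h1 (k + 1) (by omega)
    have h3 := content_take_succ s.1 ⟨k, hk⟩
    have h4 := content_take_succ s'.1 ⟨k, hk'⟩
    simp only at h3 h4
    rw [h3, h4, h1 k (by omega), add_right_inj] at h2
    have h5 := congrFun h2 (s.1.get ⟨k, hk⟩)
    rw [Pi.single_eq_same, Pi.single_apply] at h5
    by_contra hne
    rw [if_neg hne] at h5
    exact one_ne_zero h5
  · intro β
    have h1 : ∀ k : Fin (∑ i, ν i), ∃ i, β.1 k.succ = β.1 k.castSucc + Pi.single i 1 := fun k =>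
      exists_eq_add_single (β.2.1 k.castSucc_lt_succ).le (by
        rw [β.sum_eq, β.sum_eq, Fin.val_succ, Fin.val_castSucc])
    choose g hg using h1
    let s := List.ofFn g
    have hs : ∀ k : Fin (∑ i, ν i + 1), content (s.take k) = β.1 k := by
      intro k
      induction k using Fin.induction with
      | zero => exact β.2.2.1.symm
      | succ k ih =>
        have := content_take_succ s ⟨k, by simp [s]⟩
        simp only at this
        rw [Fin.val_succ, this, hg, ← ih]
        simp [s]
    have hmem : s ∈ Seq ν := by
      have := hs (Fin.last _)
      rw [β.2.2.2, Fin.val_last, List.take_of_length_le (by simp [s])] at this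
      exact this
    exact ⟨⟨s, hmem⟩, Subtype.ext (funext hs)⟩

end StrictChains

/-! ### Asymptotics of the flag measures. -/

section FlagMeasure

variable {I : Type v} [Fintype I] {Γ : SimpleGraph I} (M : QuiverRep.{u} Γ)

theorem flagMeasure_eq_sum (n : ℕ) [Fintype (weakChains (dimVec M) n)] :
    flagMeasure M n = ∑ d : weakChains (dimVec M) n, (eulerChar (dimChains M d.1) : ℂ) •
      VectorMeasure.dirac (-toWeight (∑ k : Fin n, d.1 k.succ.castSucc)) (1 : ℂ) := by
  classical
  let σ : weakChains (dimVec M) n → I → ℕ := fun d => ∑ k : Fin n, d.1 k.succ.castSucc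
  have h : ∀ μ : I → ℕ, (eulerChar (flagVariety M n μ) : ℂ) •
      VectorMeasure.dirac (-toWeight μ) (1 : ℂ) = ∑ d with σ d = μ,
        (eulerChar (dimChains M d.1) : ℂ) • VectorMeasure.dirac (-toWeight (σ d)) (1 : ℂ) := by
    intro μ
    rw [eulerChar_flagVariety, finsum_eq_sum_of_fintype, Int.cast_sum]
    refine (Finset.sum_smul (R := ℂ) (M := ComplexMeasure (I → ℝ))).trans ?_
    rw [Finset.sum_subtype (p := fun d => σ d = μ) (Finset.univ.filter fun d => σ d = μ) (by simp)]
    refine Fintype.sum_congr _ _ fun d => ?_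
    rw [show σ d = μ from d.2]
  unfold flagMeasure
  simp_rw [h]
  rw [finsum_eq_sum_of_support_subset (s := Finset.univ.image σ)]
  · exact Finset.sum_fiberwise_of_maps_to (fun d _ => Finset.mem_image_of_mem σ (Finset.mem_univ d)) _
  · intro μ hμ
    obtain ⟨d, hd, -⟩ := Finset.exists_ne_zero_of_sum_ne_zero (Function.mem_support.1 hμ)
    exact Finset.mem_coe.2 (Finset.mem_image.2 ⟨d, Finset.mem_univ d, (Finset.mem_filter.1 hd).2⟩)

omit [Fintype I] in
theorem smul_tauPush_sum {ι : Type*} [Fintype ι] (z : ℂ) (n : ℕ) (m : ι → ComplexMeasure (I → ℝ)) :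
    z • tauPush n (∑ d, m d) = ∑ d, z • tauPush n (m d) := by
  rw [← Finset.smul_sum]
  congr 1
  exact map_sum (VectorMeasure.mapₗ (R := ℂ) fun x : I → ℝ => (1 / (n : ℝ)) • x) m Finset.univ

theorem integral_smul_tauPush_smul_dirac (z c : ℂ) (n : ℕ) (y : I → ℝ) (φ : (I → ℝ) → ℝ) :
    VectorMeasure.Integrable (z • tauPush n (c • VectorMeasure.dirac y (1 : ℂ))) φ ∧
      ∫ᵛ x, φ x ∂•(z • tauPush n (c • VectorMeasure.dirac y (1 : ℂ))) =
        φ ((1 / (n : ℝ)) • y) • (z * c) := by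
  have hτ : Measurable fun x : I → ℝ => (1 / (n : ℝ)) • x := by fun_prop
  have key := integral_complexMeasure_of_apply_eq (ν := Measure.dirac ((1 / (n : ℝ)) • y))
    (z := z * c) (m := z • tauPush n (c • VectorMeasure.dirac y (1 : ℂ))) (fun s hs => ?_)
    (f := φ) (integrable_dirac (by simp))
  · rwa [integral_dirac] at key
  · have hs' := hτ hs
    rw [smul_apply, tauPush, VectorMeasure.map_apply _ hτ hs, smul_apply]
    rw [measureReal_def, Measure.dirac_apply' _ hs]
    by_cases hy : (1 / (n : ℝ)) • y ∈ s
    · rw [VectorMeasure.dirac_apply_of_mem hs' (show y ∈ _ from hy), Set.indicator_of_mem hy]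
      simp
    · rw [VectorMeasure.dirac_apply_of_notMem (show y ∉ _ from hy), Set.indicator_of_notMem hy]
      simp

theorem integral_smul_tauPush_flagMeasure (z : ℂ) (n : ℕ) [Fintype (weakChains (dimVec M) n)]
    (φ : (I → ℝ) → ℝ) :
    ∫ᵛ x, φ x ∂•(z • tauPush n (flagMeasure M n)) =
      ∑ d : weakChains (dimVec M) n,
        φ ((1 / (n : ℝ)) • -∑ k : Fin n, toWeight (d.1 k.succ.castSucc)) •
          (z * (eulerChar (dimChains M d.1) : ℂ)) := by
  rw [flagMeasure_eq_sum, smul_tauPush_sum, VectorMeasure.integral_finsetSum_vectorMeasure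
    fun d _ => (integral_smul_tauPush_smul_dirac _ _ _ _ φ).1]
  refine Finset.sum_congr rfl fun d _ => ?_
  rw [(integral_smul_tauPush_smul_dirac _ _ _ _ φ).2]
  congr 4
  ext i
  simp [toWeight]

/-- Groups the weak chains by their underlying strict chain; the Euler characteristic then leaves
the sum over surjections, since repetitions do not affect it. -/
theorem integral_smul_tauPush_flagMeasure_eq_sum (z : ℂ) (n : ℕ) (φ : (I → ℝ) → ℝ) :
    ∫ᵛ x, φ x ∂•(z • tauPush n (flagMeasure M n)) =
      ∑ r : Fin (∑ i, dimVec M i + 1), ∑ β : StrictChain (dimVec M) r,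
        ((∑ f : MonoSurj (n + 2) (r + 1),
          φ ((1 / (n : ℝ)) • -∑ k : Fin n, toWeight (β.1 (f.1 k.succ.castSucc))) : ℝ) : ℂ) *
          (z * (eulerChar (dimChains M β.1) : ℂ)) := by
  have := Fintype.ofFinite (weakChains (dimVec M) n)
  rw [integral_smul_tauPush_flagMeasure, sum_weakChains fun d : Fin (n + 2) → I → ℕ =>
    φ ((1 / (n : ℝ)) • -∑ k : Fin n, toWeight (d k.succ.castSucc)) •
      (z * (eulerChar (dimChains M d) : ℂ))]
  refine Finset.sum_congr rfl fun r _ => Finset.sum_congr rfl fun β _ => ?_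
  rw [Complex.ofReal_sum, Finset.sum_mul]
  refine Finset.sum_congr rfl fun f _ => ?_
  rw [← eulerChar_congr (dimChainsComp M β.1 f.2.1 f.2.2), Complex.real_smul]
  rfl

theorem tendsto_integral_flagMeasure {φ : (I → ℝ) → ℝ} (hφ : Continuous φ) :
    Tendsto (fun n : ℕ => ∫ᵛ x, φ x ∂•(((((n : ℝ) ^ (∑ i, dimVec M i))⁻¹ : ℝ) : ℂ) •
      tauPush n (flagMeasure M n))) atTop
      (𝓝 (∑ β : StrictChain (dimVec M) (∑ i, dimVec M i),
        ((∫ x in solidSimplex (∑ i, dimVec M i),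
          φ (simplexPoint (fun k => toWeight (β.1 k)) x) : ℝ) : ℂ) *
            (eulerChar (dimChains M β.1) : ℂ))) := by
  -- Separates the maximal length `r = ∑ νᵢ` from the shorter ones, whose sums have order `n ^ r`
  -- and vanish after division by the larger power of `n`.
  simp_rw [integral_smul_tauPush_flagMeasure_eq_sum, Fin.sum_univ_castSucc]
  rw [← zero_add (∑ β : StrictChain (dimVec M) (∑ i, dimVec M i), _)]
  refine Tendsto.add ?_ (tendsto_finsetSum _ fun β _ => ?_)
  · rw [← Finset.sum_const_zero (M := ℂ) (s := (Finset.univ : Finset (Fin (∑ i, dimVec M i))))]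
    refine tendsto_finsetSum _ fun r _ => ?_
    rw [← Finset.sum_const_zero (M := ℂ)
      (s := (Finset.univ : Finset (StrictChain (dimVec M) (Fin.castSucc r))))]
    refine tendsto_finsetSum _ fun β _ => ?_
    have h1 := tendsto_sum_monoSurj (fun k => toWeight (β.1 k)) hφ
    have h2 : Tendsto (fun n : ℕ => ((n : ℝ) ^ (∑ i, dimVec M i - r))⁻¹) atTop (𝓝 0) :=
      ((tendsto_pow_atTop (Nat.sub_pos_of_lt r.2).ne').comp
        tendsto_natCast_atTop_atTop).inv_tendsto_atTop
    have h3 := ((Complex.continuous_ofReal.tendsto _).comp (h1.mul h2)).mul_const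
      (eulerChar (dimChains M β.1) : ℂ)
    rw [mul_zero, Complex.ofReal_zero, zero_mul] at h3
    refine h3.congr fun n => ?_
    rw [Function.comp_apply, ← mul_assoc, ← Complex.ofReal_mul, div_eq_mul_inv, mul_assoc,
      ← mul_inv, ← pow_add]
    simp only [Fin.val_castSucc]
    rw [Nat.add_sub_cancel' r.2.le]
  · have h1 := tendsto_sum_monoSurj (fun k => toWeight (β.1 k)) hφ
    refine (((Complex.continuous_ofReal.tendsto _).comp h1).mul_const
      (eulerChar (dimChains M β.1) : ℂ)).congr fun n => ?_
    rw [Function.comp_apply, ← mul_assoc, ← Complex.ofReal_mul, div_eq_mul_inv]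
    rfl

end FlagMeasure

/-! ### The measure `D(ξ_M)` and the conclusion. -/

section Xi

variable {I : Type v} [Fintype I] [DecidableEq I] {Γ : SimpleGraph I} (M : QuiverRep.{u} Γ)

theorem integral_xiMeasure {φ : (I → ℝ) → ℝ} (hφ : Continuous φ) :
    ∫ᵛ x, φ x ∂•(xiMeasure M) = ∑ β : StrictChain (dimVec M) (∑ i, dimVec M i),
      ((∫ x in solidSimplex (∑ i, dimVec M i),
        φ (simplexPoint (fun k => toWeight (β.1 k)) x) : ℝ) : ℂ) *
          (eulerChar (dimChains M β.1) : ℂ) := by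
  have : Fintype (Seq (dimVec M)) := (finite_Seq (dimVec M)).fintype
  rw [xiMeasure, finsum_mem_eq_finite_toFinset_sum _ (finite_Seq (dimVec M)),
    VectorMeasure.integral_finsetSum_vectorMeasure
      fun s _ => (integral_smul_seqComplexMeasure _ s hφ).1,
    Finset.sum_subtype (p := (· ∈ Seq (dimVec M))) _ (by simp),
    ← (seqChain_bijective (dimVec M)).sum_comp]
  refine Fintype.sum_congr _ _ fun s => ?_
  rw [(integral_smul_seqComplexMeasure _ s.1 hφ).2, compSeries_eq_dimChains M s.2,
    Complex.real_smul]
  -- The length of `s` equals the height of `ν` only propositionally, and it occurs in types;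
  -- generalizing the height allows substitution.
  have key : ∀ m : ℕ, s.1.length = m →
      ((∫ x in solidSimplex s.1.length, φ (simplexPoint
        (fun k : Fin (s.1.length + 1) => toWeight (content (s.1.take k))) x) : ℝ) : ℂ) *
          (eulerChar (dimChains M fun k : Fin (s.1.length + 1) => content (s.1.take k)) : ℂ) =
      ((∫ x in solidSimplex m, φ (simplexPoint
        (fun k : Fin (m + 1) => toWeight (content (s.1.take k))) x) : ℝ) : ℂ) *
          (eulerChar (dimChains M fun k : Fin (m + 1) => content (s.1.take k)) : ℂ) := by
    rintro m rfl
    rfl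
  exact key _ (length_of_mem_Seq s.2)

variable [DecidableRel Γ.Adj]

/-- An element of weight `-ν` annihilates every monomial of another weight, so only sequences in
`Seq(ν)` contribute. -/
theorem mapD_eq_xiMeasure {ξ : coordRing Γ} (hξ : IsXi M ξ) : mapD ξ = xiMeasure M := by
  classical
  refine finsum_congr fun s => ?_
  by_cases hs : s ∈ Seq (dimVec M)
  · rw [finsum_eq_if, if_pos hs, hξ.2 s hs]
  · rw [finsum_eq_if, if_neg hs]
    have h1 := (Submodule.mem_iInf _).1 hξ.1 ⟨content s, hs⟩
    rw [(Submodule.mem_dualAnnihilator _).1 h1 _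
      (Submodule.subset_span (Set.mem_image_of_mem _ rfl))]
    exact zero_smul ℂ (seqComplexMeasure s)

theorem isWeakLimit_xiMeasure (hΓ : IsSimplyLacedDynkin Γ) :
    IsWeakLimit (fun n : ℕ => (((((n : ℝ) ^ rhoCheck Γ (dimVec M))⁻¹ : ℝ)) : ℂ) •
      tauPush n (flagMeasure M n)) (xiMeasure M) := by
  intro φ hφ
  rw [integral_xiMeasure M hφ, rhoCheck_eq hΓ]
  simp_rw [Real.rpow_natCast]
  exact tendsto_integral_flagMeasure M hφ

end Xi

end PreprojDH

end

theorem mainTheorem8 {I : Type*} [Fintype I] [DecidableEq I]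
    (Γ : SimpleGraph I) [DecidableRel Γ.Adj] (hΓ : PreprojDH.IsSimplyLacedDynkin Γ)
    (τ : Γ.Dart → ℤˣ) (hτ : ∀ h : Γ.Dart, τ h.symm = -τ h)
    (M : PreprojDH.QuiverRep Γ) (hM : PreprojDH.IsPreprojective τ M) :
    (∀ ξ : PreprojDH.coordRing Γ, PreprojDH.IsXi M ξ →
      PreprojDH.IsWeakLimit
        (fun n : ℕ => (((((n : ℝ) ^ PreprojDH.rhoCheck Γ (PreprojDH.dimVec M))⁻¹ : ℝ)) : ℂ) •
          PreprojDH.tauPush n (PreprojDH.flagMeasure M n))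
        (PreprojDH.mapD ξ)) ∧
    PreprojDH.IsWeakLimit
      (fun n : ℕ => (((((n : ℝ) ^ PreprojDH.rhoCheck Γ (PreprojDH.dimVec M))⁻¹ : ℝ)) : ℂ) •
        PreprojDH.tauPush n (PreprojDH.flagMeasure M n))
      (PreprojDH.xiMeasure M) := by
  refine ⟨fun ξ hξ => ?_, PreprojDH.isWeakLimit_xiMeasure M hΓ⟩
  rw [PreprojDH.mapD_eq_xiMeasure M hξ]
  exact PreprojDH.isWeakLimit_xiMeasure M hΓ
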